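/- Let $(X,d)$ be a proper geodesic metric space that is $\delta$-hyperbolic for some $\delta>0$, i.e. each point on an edge of a geodesic triangle in $X$ is within distance $\delta$ of the union of the other two edges. Put $(x|y)_w=\frac12\big(d(x,w)+d(y,w)-d(x,y)\big)$. The Gromov boundary $\partial X$ is the set of equivalence classes of sequences $(x_i)$ in $X$ with $(x_i|x_j)_w\to\infty$ as $i,j\to\infty$ (Gromov sequences), where $(x_i)\sim(y_i)$ if $(x_i|y_i)_w\to\infty$; these notions do not depend on $w\in X$. Assume that $X$ has a pole: there are $L\ge 0$ and a point $o\in X\cup\partial X$ such that each $x\in X$ lies within distance $L$ of some geodesic connecting $o$ to some point $v\in\partial X$ (a geodesic ray from $o$ to $v$ if $o\in X$, a bi-infinite geodesic from $o$ to $v$ if $o\in\partial X$). For $\xi,\zeta\in\partial X$ let $(\xi|\zeta)_w=\inf\{\liminf_{i\to\infty}(x_i|y_i)_w : (x_i)\in\xi,\ (y_i)\in\zeta\}\in[0,\infty]$. For $w\in X$ and $0<\varepsilon<\min\{1,\frac1{5\delta}\}$ let $d_{w,\varepsilon}$ be the visual metric $$d_{w,\varepsilon}(\xi,\zeta)=\inf\Big\{\sum_{i=1}^n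 e^{-\varepsilon(\xi_{i-1}|\xi_i)_w} : n\ge1,\ \xi=\xi_0,\xi_1,\dots,\xi_n=\zeta\in\partial X\Big\},\qquad e^{-\infty}=0.$$ Then, for every such $\delta$, $w$ and $\varepsilon$, the following are equivalent. 1. $X$ is boundary rigid: every map $f:X\to X$ that is a quasi-isometry (for some $K\ge1$, $C\ge0$, all $x,y\in X$ satisfy $K^{-1}d(x,y)-C\le d(f(x),f(y))\le Kd(x,y)+C$, and every point of $X$ is within $C$ of $f(X)$) and whose induced map $[(x_i)]\mapsto[(f(x_i))]$ on $\partial X$ is the identity satisfies $\sup_{x\in X}d(x,f(x))<\infty$. 2. $(\partial X,d_{w,\varepsilon})$ is uniformly perfect: there are $S\ge1$ and $r_0>0$ such that for each $\xi\in\partial X$ and each $0<r\le r_0$ there is $\zeta\in\partial X$ with $r/S<d_{w,\varepsilon}(\xi,\zeta)\le r$. -/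

import Mathlib

open Filter

namespace BoundaryRigidity

noncomputable section

/-- `s` is (the image of) a geodesic segment from `x` to `y`, parametrized by arc length. -/
def IsGeodesicSegment {X : Type*} [MetricSpace X] (x y : X) (s : Set X) : Prop :=
  ∃ γ : ℝ → X, γ 0 = x ∧ γ (dist x y) = y ∧
    (∀ a ∈ Set.Icc 0 (dist x y), ∀ b ∈ Set.Icc 0 (dist x y), dist (γ a) (γ b) = |a - b|) ∧
    s = γ '' Set.Icc 0 (dist x y)

/-- Every two points are joined by a geodesic segment. -/
def IsGeodesicSpace (X : Type*) [MetricSpace X] : Prop :=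
  ∀ x y : X, ∃ s : Set X, IsGeodesicSegment x y s

/-- `δ`-hyperbolicity: each point on an edge of a geodesic triangle is within distance `δ` of the
union of the other two edges. -/
def IsDeltaHyperbolic (X : Type*) [MetricSpace X] (δ : ℝ) : Prop :=
  ∀ (x y z : X) (a b c : Set X),
    IsGeodesicSegment x y a → IsGeodesicSegment y z b → IsGeodesicSegment z x c →
      ∀ p ∈ a, ∃ q ∈ b ∪ c, dist p q ≤ δ

/-- The Gromov product `(x|y)_w`. -/
def gromovProduct {X : Type*} [MetricSpace X] (w x y : X) : ℝ :=
  (dist x w + dist y w - dist x y) / 2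

/-- Gromov sequences: `(x_i|x_j)_w → ∞` as `i, j → ∞`. Changing the base point `w` changes the
Gromov product by a bounded amount only, so asking this for one `w` or for all `w` is the same. -/
def IsGromovSeq {X : Type*} [MetricSpace X] (x : ℕ → X) : Prop :=
  ∀ w : X, Tendsto (fun p : ℕ × ℕ => gromovProduct w (x p.1) (x p.2)) atTop atTop

/-- The type of Gromov sequences. -/
def GromovSeq (X : Type*) [MetricSpace X] : Type _ := {x : ℕ → X // IsGromovSeq x}

/-- Equivalence of Gromov sequences: `(x_i|y_i)_w → ∞`. -/
def GromovEquiv {X : Type*} [MetricSpace X] (x y : GromovSeq X) : Prop :=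
  ∀ w : X, Tendsto (fun i : ℕ => gromovProduct w (x.1 i) (y.1 i)) atTop atTop

/-- The Gromov boundary: equivalence classes of Gromov sequences. (In a hyperbolic space
`GromovEquiv` is an equivalence relation, so `Quot` is the quotient by it.) -/
def GromovBoundary (X : Type*) [MetricSpace X] : Type _ := Quot (@GromovEquiv X _)

/-- The class of a Gromov sequence. -/
def GromovBoundary.mk {X : Type*} [MetricSpace X] (x : GromovSeq X) : GromovBoundary X :=
  Quot.mk _ x

/-- `x` is a Gromov sequence and belongs to the class `ξ`. -/
def Represents {X : Type*} [MetricSpace X] (x : ℕ → X) (ξ : GromovBoundary X) : Prop :=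
  ∃ h : IsGromovSeq x, GromovBoundary.mk ⟨x, h⟩ = ξ

/-- The Gromov closure, the disjoint union of `X` and its Gromov boundary. -/
abbrev GromovClosure (X : Type*) [MetricSpace X] : Type _ := X ⊕ GromovBoundary X

/-- `s` is (the image of) a geodesic connecting a point of the Gromov closure to the boundary point
`v`: a geodesic ray if the first point is in `X`, a geodesic line if it is in the boundary. -/
def IsGeodesicToBoundary {X : Type*} [MetricSpace X] :
    GromovClosure X → GromovBoundary X → Set X → Prop
  | Sum.inl o, v, s => ∃ γ : ℝ → X, γ 0 = o ∧
      (∀ a ∈ Set.Ici (0 : ℝ), ∀ b ∈ Set.Ici (0 : ℝ), dist (γ a) (γ b) = |a - b|) ∧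
      Represents (fun n : ℕ => γ n) v ∧ s = γ '' Set.Ici 0
  | Sum.inr ξ, v, s => ∃ γ : ℝ → X, (∀ a b : ℝ, dist (γ a) (γ b) = |a - b|) ∧
      Represents (fun n : ℕ => γ (-(n : ℝ))) ξ ∧ Represents (fun n : ℕ => γ n) v ∧
      s = Set.range γ

/-- `X` has an `L`-pole. -/
def HasLPole (X : Type*) [MetricSpace X] (L : ℝ) : Prop :=
  ∃ o : GromovClosure X, ∀ x : X, ∃ (v : GromovBoundary X) (s : Set X),
    IsGeodesicToBoundary o v s ∧ ∃ p ∈ s, dist x p ≤ L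

/-- `X` has a pole. -/
def HasPole (X : Type*) [MetricSpace X] : Prop :=
  ∃ L : ℝ, 0 ≤ L ∧ HasLPole X L

/-- `(K, C)`-quasi-isometries. -/
def IsQuasiIsometryWith {X Y : Type*} [MetricSpace X] [MetricSpace Y] (K C : ℝ) (f : X → Y) :
    Prop :=
  (∀ x y : X, K⁻¹ * dist x y - C ≤ dist (f x) (f y) ∧ dist (f x) (f y) ≤ K * dist x y + C) ∧
    ∀ y : Y, ∃ x : X, dist y (f x) ≤ C

/-- Quasi-isometries (not assumed to be continuous). -/
def IsQuasiIsometry {X Y : Type*} [MetricSpace X] [MetricSpace Y] (f : X → Y) : Prop :=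
  ∃ K C : ℝ, 1 ≤ K ∧ 0 ≤ C ∧ IsQuasiIsometryWith K C f

/-- `F` is the map on Gromov boundaries induced by `f`, that is, `F [x_i] = [f (x_i)]` for every
Gromov sequence `x_i` in `X`. -/
def InducesBoundaryMap {X Y : Type*} [MetricSpace X] [MetricSpace Y] (f : X → Y)
    (F : GromovBoundary X → GromovBoundary Y) : Prop :=
  ∀ x : GromovSeq X, Represents (fun i => f (x.1 i)) (F (GromovBoundary.mk x))

/-- Boundary rigidity: every self quasi-isometry inducing the identity on the Gromov boundary has
finite displacement. -/
def BoundaryRigid (X : Type*) [MetricSpace X] : Prop :=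
  ∀ f : X → X, IsQuasiIsometry f → InducesBoundaryMap f id → ∃ M : ℝ, ∀ x : X, dist x (f x) ≤ M

/-- The Gromov product `(ξ|ζ)_w` of two boundary points, the infimum of
`liminf (x_i|y_i)_w` over all `x ∈ ξ` and `y ∈ ζ`; it is `⊤` when `ξ = ζ`. -/
def boundaryGromovProduct {X : Type*} [MetricSpace X] (w : X) (ξ ζ : GromovBoundary X) : EReal :=
  ⨅ (x : GromovSeq X) (y : GromovSeq X) (_ : GromovBoundary.mk x = ξ)
    (_ : GromovBoundary.mk y = ζ),
    liminf (fun i : ℕ => ((gromovProduct w (x.1 i) (y.1 i) : ℝ) : EReal)) atTop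

open Classical in
/-- `ρ(ξ, ζ) = exp (-ε (ξ|ζ)_w)`, with `exp (-∞) = 0`. -/
def visualRho {X : Type*} [MetricSpace X] (w : X) (ε : ℝ) (ξ ζ : GromovBoundary X) : ℝ :=
  if boundaryGromovProduct w ξ ζ = ⊤ then 0
  else Real.exp (-ε * (boundaryGromovProduct w ξ ζ).toReal)

/-- The visual metric with base point `w` and parameter `ε`: the infimum of
`∑ ρ(ξ_{i-1}, ξ_i)` over all chains `ξ = ξ_0, …, ξ_n = ζ` with `n ≥ 1`. -/
def visualDist {X : Type*} [MetricSpace X] (w : X) (ε : ℝ) (ξ ζ : GromovBoundary X) : ℝ :=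
  sInf {r : ℝ | ∃ (n : ℕ) (c : ℕ → GromovBoundary X), 1 ≤ n ∧ c 0 = ξ ∧ c n = ζ ∧
    r = ∑ i ∈ Finset.range n, visualRho w ε (c i) (c (i + 1))}

/-- Uniform perfectness of a set `Y` with distance function `d`. -/
def UniformlyPerfect {Y : Type*} (d : Y → Y → ℝ) : Prop :=
  ∃ S : ℝ, 1 ≤ S ∧ ∃ r₀ : ℝ, 0 < r₀ ∧
    ∀ (x : Y) (r : ℝ), 0 < r → r ≤ r₀ → ∃ y : Y, r / S < d x y ∧ d x y ≤ r

end

end BoundaryRigidity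

open BoundaryRigidity

/-!
The statement is read off from Gromov products at the base point `w`. Slim triangles with constant
`δ` give `(x|z) ≥ min (x|y) (y|z) - 3δ` (`IsDeltaHyperbolic.gromovHyperbolic`), and since
`exp (3δε) ≤ 2`, Frink's chain lemma shows that `visualDist` is comparable to `exp (-ε (ξ|ζ)_w)`.
Hence uniform perfectness means that the Gromov products `(ξ|ζ)_w`, with `ξ` fixed, are relatively
dense in a half-line, uniformly in `ξ` (`uniformlyPerfect_visualDist_iff`). The pole is used only
through `HasPole.exists_gromovSeq`: up to a bounded error, every point of `X` lies on the way from `w`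
to some boundary point.

If the boundary is uniformly perfect, every point far from `w` is a quasi-centre of three boundary
points, uniformly (`exists_quasi_center`). A quasi-isometry `f` maps quasi-centres to quasi-centres of
the image points, by stability of quasi-geodesics (`exists_gromovProduct_map_le`). When `f` fixes the
boundary, `p` and `f p` are quasi-centres of the same three boundary points, so they are close to each
other.

If the boundary is not uniformly perfect, there are arbitrarily long windows free of Gromov products
`(ξ|ζ)_w`. Such a window produces a neck, a part of `X` at bounded distance from a long geodesic segment
and separating the two sides (`exists_neck`). Choosing necks of growing length at disjoint heights and
sliding the points of each neck along its core by a fixed proportion of its length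
(`moveAll`) gives a quasi-isometry that fixes the boundary and has infinite displacement.
-/

namespace BoundaryRigidity

/-! ### Geodesics and the Gromov product -/

section Basic

variable {X : Type*} [MetricSpace X]

lemma gromovProduct_comm (w x y : X) : gromovProduct w x y = gromovProduct w y x := by
  simp only [gromovProduct, dist_comm x y]; ring

lemma gromovProduct_nonneg (w x y : X) : 0 ≤ gromovProduct w x y := by
  have := dist_triangle_right x y w
  simp only [gromovProduct]; linarith

lemma gromovProduct_le_left (w x y : X) : gromovProduct w x y ≤ dist x w := by
  have h := dist_triangle y x w
  rw [dist_comm y x] at h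
  simp only [gromovProduct]; linarith

lemma gromovProduct_le_right (w x y : X) : gromovProduct w x y ≤ dist y w := by
  rw [gromovProduct_comm]; exact gromovProduct_le_left w y x

lemma gromovProduct_self (w x : X) : gromovProduct w x x = dist x w := by
  simp [gromovProduct]

/-- The two Gromov products of `a` seen from the ends of a segment add up to its length. -/
lemma gromovProduct_add (a p q : X) :
    gromovProduct p a q + gromovProduct q a p = dist p q := by
  simp only [gromovProduct, dist_comm q p]; ring

/-- Change of base point. -/
lemma gromovProduct_base (w p a b : X) :
    gromovProduct p a b =
      gromovProduct w a b + dist p w - gromovProduct w a p - gromovProduct w b p := by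
  simp only [gromovProduct]; ring

lemma gromovProduct_le_add_dist (w w' x y : X) :
    gromovProduct w x y ≤ gromovProduct w' x y + dist w w' := by
  have h1 := dist_triangle x w' w
  have h2 := dist_triangle y w' w
  rw [dist_comm w' w] at h1 h2
  simp only [gromovProduct]; linarith

/-- `γ` restricted to `[0, d(x, y)]` is a geodesic from `x` to `y`. -/
def IsGeodesicPath (x y : X) (γ : ℝ → X) : Prop :=
  γ 0 = x ∧ γ (dist x y) = y ∧
    ∀ a ∈ Set.Icc 0 (dist x y), ∀ b ∈ Set.Icc 0 (dist x y), dist (γ a) (γ b) = |a - b|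

lemma IsGeodesicSpace.exists_path (hgeo : IsGeodesicSpace X) (x y : X) :
    ∃ γ, IsGeodesicPath x y γ := by
  obtain ⟨s, γ, h0, h1, h2, -⟩ := hgeo x y
  exact ⟨γ, h0, h1, h2⟩

lemma IsGeodesicPath.segment {x y : X} {γ : ℝ → X} (h : IsGeodesicPath x y γ) :
    IsGeodesicSegment x y (γ '' Set.Icc 0 (dist x y)) :=
  ⟨γ, h.1, h.2.1, h.2.2, rfl⟩

/-- A subpath of a geodesic, reparametrized from `0`. -/
lemma IsGeodesicPath.sub {x y : X} {γ : ℝ → X} (h : IsGeodesicPath x y γ) {a b : ℝ} (ha : 0 ≤ a)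
    (hab : a ≤ b) (hb : b ≤ dist x y) :
    IsGeodesicPath (γ a) (γ b) (fun t => γ (a + t)) := by
  have hd : dist (γ a) (γ b) = b - a := by
    rw [h.2.2 a ⟨ha, hab.trans hb⟩ b ⟨ha.trans hab, hb⟩, abs_sub_comm, abs_of_nonneg (by linarith)]
  refine ⟨by simp, by simp [hd], ?_⟩
  rw [hd]
  intro s hs t ht
  rw [h.2.2 _ ⟨by linarith [hs.1], by linarith [hs.2]⟩ _ ⟨by linarith [ht.1], by linarith [ht.2]⟩]
  congr 1; ring

lemma IsGeodesicSegment.symm {x y : X} {s : Set X} (h : IsGeodesicSegment x y s) :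
    IsGeodesicSegment y x s := by
  obtain ⟨γ, h0, h1, h2, rfl⟩ := h
  refine ⟨fun t => γ (dist x y - t), by simpa using h1, by simpa [dist_comm y x] using h0, ?_, ?_⟩
  · rw [dist_comm y x]
    intro a ha b hb
    rw [h2 _ ⟨by linarith [ha.2], by linarith [ha.1]⟩ _ ⟨by linarith [hb.2], by linarith [hb.1]⟩,
      abs_sub_comm]
    congr 1; ring
  · rw [dist_comm y x]
    ext p
    constructor
    · rintro ⟨t, ht, rfl⟩
      exact ⟨dist x y - t, ⟨by linarith [ht.2], by linarith [ht.1]⟩, by simp⟩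
    · rintro ⟨t, ht, rfl⟩
      exact ⟨dist x y - t, ⟨by linarith [ht.2], by linarith [ht.1]⟩, rfl⟩

lemma IsGeodesicSegment.left_mem {x y : X} {s : Set X} (h : IsGeodesicSegment x y s) : x ∈ s := by
  obtain ⟨γ, h0, h1, h2, rfl⟩ := h
  exact ⟨0, ⟨le_rfl, dist_nonneg⟩, h0⟩

lemma IsGeodesicSegment.dist_add {x y : X} {s : Set X} (h : IsGeodesicSegment x y s) {p : X}
    (hp : p ∈ s) : dist x p + dist p y = dist x y := by
  obtain ⟨γ, h0, h1, h2, rfl⟩ := h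
  obtain ⟨t, ht, rfl⟩ := hp
  have e1 := h2 0 ⟨le_rfl, dist_nonneg⟩ t ht
  have e2 := h2 t ht (dist x y) ⟨dist_nonneg, le_rfl⟩
  rw [h0, abs_sub_comm, abs_of_nonneg (by linarith [ht.1])] at e1
  rw [h1, abs_sub_comm, abs_of_nonneg (by linarith [ht.2])] at e2
  linarith

lemma continuousOn_of_dist_eq {γ : ℝ → X} {s : Set ℝ}
    (h : ∀ a ∈ s, ∀ b ∈ s, dist (γ a) (γ b) = |a - b|) : ContinuousOn γ s := by
  have : LipschitzOnWith 1 γ s := LipschitzOnWith.of_dist_le_mul fun a ha b hb => by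
    rw [h a ha b hb, Real.dist_eq]; simp
  exact this.continuousOn

lemma IsGeodesicSegment.isCompact {x y : X} {s : Set X} (h : IsGeodesicSegment x y s) :
    IsCompact s := by
  obtain ⟨γ, h0, h1, h2, rfl⟩ := h
  exact isCompact_Icc.image_of_continuousOn (continuousOn_of_dist_eq h2)

lemma IsGeodesicSegment.isPreconnected {x y : X} {s : Set X} (h : IsGeodesicSegment x y s) :
    IsPreconnected s := by
  obtain ⟨γ, h0, h1, h2, rfl⟩ := h
  exact isPreconnected_Icc.image _ (continuousOn_of_dist_eq h2)

lemma gromovProduct_le_dist_of_mem {x y : X} {s : Set X} (h : IsGeodesicSegment x y s) {p : X}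
    (hp : p ∈ s) (w : X) : gromovProduct w x y ≤ dist w p := by
  have e := h.dist_add hp
  have h1 := dist_triangle x p w
  have h2 := dist_triangle y p w
  rw [dist_comm p w] at h1 h2
  rw [dist_comm y p] at h2
  simp only [gromovProduct]; linarith

/-- In a `δ`-slim space, a geodesic `[x, y]` comes within `(x|y)_w + 2δ` of `w`. By connectedness
some point of `[x, y]` is `δ`-close to both `[w, x]` and `[w, y]`. -/
lemma exists_mem_dist_le (hgeo : IsGeodesicSpace X) {δ : ℝ} (hhyp : IsDeltaHyperbolic X δ)
    {x y : X} {s : Set X} (h : IsGeodesicSegment x y s) (w : X) :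
    ∃ p ∈ s, dist w p ≤ gromovProduct w x y + 2 * δ := by
  obtain ⟨b, hb⟩ := hgeo y w
  obtain ⟨c, hc⟩ := hgeo w x
  have hδ : 0 ≤ δ := by
    obtain ⟨q, -, hq⟩ := hhyp x y w s b c h hb hc x h.left_mem
    exact dist_nonneg.trans hq
  have hcl : ∀ t : Set X, IsClosed {q : X | Metric.infDist q t ≤ δ} := fun t =>
    isClosed_le (Metric.continuous_infDist_pt t) continuous_const
  have hne : (s ∩ ({q : X | Metric.infDist q b ≤ δ} ∩ {q : X | Metric.infDist q c ≤ δ})).Nonempty := by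
    refine isPreconnected_closed_iff.1 h.isPreconnected _ _ (hcl b) (hcl c) ?_ ?_ ?_
    · intro p hp
      obtain ⟨q, hq, hpq⟩ := hhyp x y w s b c h hb hc p hp
      rcases hq with hq | hq
      · exact Or.inl ((Metric.infDist_le_dist_of_mem hq).trans hpq)
      · exact Or.inr ((Metric.infDist_le_dist_of_mem hq).trans hpq)
    · exact ⟨y, h.symm.left_mem, by
        simpa [Metric.infDist_zero_of_mem hb.left_mem] using hδ⟩
    · exact ⟨x, h.left_mem, by
        simpa [Metric.infDist_zero_of_mem hc.symm.left_mem] using hδ⟩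
  obtain ⟨p, hp, hpb, hpc⟩ := hne
  obtain ⟨q, hq, eq⟩ := hb.isCompact.exists_infDist_eq_dist ⟨_, hb.left_mem⟩ p
  obtain ⟨r, hr, er⟩ := hc.isCompact.exists_infDist_eq_dist ⟨_, hc.left_mem⟩ p
  have hq' : dist p q ≤ δ := eq ▸ hpb
  have hr' : dist p r ≤ δ := er ▸ hpc
  refine ⟨p, hp, ?_⟩
  have e1 := hb.dist_add hq
  have e2 := hc.dist_add hr
  have e3 := h.dist_add hp
  have t1 := dist_triangle y q p
  have t2 := dist_triangle w q p
  have t3 := dist_triangle w r p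
  have t4 := dist_triangle x r p
  simp only [gromovProduct]
  rw [dist_comm y p] at t1
  rw [dist_comm w x] at e2
  rw [dist_comm r x] at e2
  rw [dist_comm q w] at e1
  rw [dist_comm q p] at t1 t2
  rw [dist_comm r p] at t3 t4
  linarith

/-- Hyperbolicity in terms of Gromov products, with constant `h`. -/
def GromovHyperbolic (X : Type*) [MetricSpace X] (h : ℝ) : Prop :=
  ∀ w x y z : X, min (gromovProduct w x y) (gromovProduct w y z) - h ≤ gromovProduct w x z

/-- Slim triangles with constant `δ` give the four-point inequality with constant `3δ`. The factor
`3` matters: it makes `exp (3δε) ≤ 2` in the range of `ε` allowed for visual metrics. -/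
theorem IsDeltaHyperbolic.gromovHyperbolic (hgeo : IsGeodesicSpace X) {δ : ℝ}
    (hhyp : IsDeltaHyperbolic X δ) : GromovHyperbolic X (3 * δ) := by
  intro w x y z
  obtain ⟨a, ha⟩ := hgeo x z
  obtain ⟨b, hb⟩ := hgeo z y
  obtain ⟨c, hc⟩ := hgeo y x
  obtain ⟨p, hp, hpw⟩ := exists_mem_dist_le hgeo hhyp ha w
  obtain ⟨q, hq, hpq⟩ := hhyp x z y a b c ha hb hc p hp
  have ht := dist_triangle w p q
  rcases hq with hq | hq
  · have := gromovProduct_le_dist_of_mem hb.symm hq w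
    linarith [min_le_right (gromovProduct w x y) (gromovProduct w y z)]
  · have := gromovProduct_le_dist_of_mem hc.symm hq w
    linarith [min_le_left (gromovProduct w x y) (gromovProduct w y z)]

namespace GromovHyperbolic

variable {h : ℝ} (H : GromovHyperbolic X h)
include H

lemma nonneg [Nonempty X] : 0 ≤ h := by
  obtain ⟨x⟩ := ‹Nonempty X›
  simpa [gromovProduct] using H x x x x

lemma le_or (w x y z : X) :
    gromovProduct w x y ≤ gromovProduct w x z + h ∨ gromovProduct w y z ≤ gromovProduct w x z + h := by
  have := H w x y z
  rcases min_choice (gromovProduct w x y) (gromovProduct w y z) with e | e <;> rw [e] at this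
  · left; linarith
  · right; linarith

lemma le_or_three (w x y z t : X) :
    gromovProduct w x y ≤ gromovProduct w x t + 2 * h ∨
      gromovProduct w y z ≤ gromovProduct w x t + 2 * h ∨
      gromovProduct w z t ≤ gromovProduct w x t + 2 * h := by
  have h0 : 0 ≤ h := haveI : Nonempty X := ⟨w⟩; H.nonneg
  rcases H.le_or w x y t with h1 | h1
  · left; linarith
  · rcases H.le_or w y z t with h2 | h2
    · right; left; linarith
    · right; right; linarith

/-- Two points that are both quasi-centres of a triangle `a, b, c` are close to each other. -/
lemma dist_le_of_centers {a b c p q : X} {C : ℝ}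
    (hab : gromovProduct p a b ≤ C) (hbc : gromovProduct p b c ≤ C) (hca : gromovProduct p c a ≤ C)
    (hab' : gromovProduct q a b ≤ C) (hbc' : gromovProduct q b c ≤ C)
    (hca' : gromovProduct q c a ≤ C) : dist p q ≤ 2 * C + 2 * h := by
  have ea := gromovProduct_add a p q
  have eb := gromovProduct_add b p q
  have ec := gromovProduct_add c p q
  have p1 := H.le_or p a q b
  have p2 := H.le_or p b q c
  have p3 := H.le_or p c q a
  have q1 := H.le_or q a p b
  have q2 := H.le_or q b p c
  have q3 := H.le_or q c p a
  rw [gromovProduct_comm p q] at p1 p2 p3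
  rw [gromovProduct_comm q p] at q1 q2 q3
  rcases p1 with p1 | p1 <;> rcases p2 with p2 | p2 <;> rcases p3 with p3 | p3 <;>
    rcases q1 with q1 | q1 <;> rcases q2 with q2 | q2 <;> rcases q3 with q3 | q3 <;> linarith

end GromovHyperbolic

end Basic

/-! ### Gromov sequences and the Gromov boundary -/

section Boundary

variable {X : Type*} [MetricSpace X]

lemma IsGromovSeq.exists_le {x : ℕ → X} (hx : IsGromovSeq x) (w : X) (b : ℝ) :
    ∃ N, ∀ i ≥ N, ∀ j ≥ N, b ≤ gromovProduct w (x i) (x j) := by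
  obtain ⟨⟨N, M⟩, h⟩ := eventually_atTop.1 (tendsto_atTop.1 (hx w) b)
  exact ⟨max N M, fun i hi j hj =>
    h (i, j) ⟨le_trans (le_max_left _ _) hi, le_trans (le_max_right _ _) hj⟩⟩

/-- A criterion at a single base point. -/
lemma isGromovSeq_of_exists_le {x : ℕ → X} (w : X)
    (hx : ∀ b : ℝ, ∃ N, ∀ i ≥ N, ∀ j ≥ N, b ≤ gromovProduct w (x i) (x j)) : IsGromovSeq x := by
  intro w'
  refine tendsto_atTop.2 fun b => ?_
  obtain ⟨N, hN⟩ := hx (b + dist w w')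
  filter_upwards [eventually_ge_atTop (N, N)] with p hp
  have := gromovProduct_le_add_dist w w' (x p.1) (x p.2)
  linarith [hN p.1 hp.1 p.2 hp.2]

lemma GromovEquiv.eventually_le {x y : GromovSeq X} (h : GromovEquiv x y) (w : X) (b : ℝ) :
    ∀ᶠ i in atTop, b ≤ gromovProduct w (x.1 i) (y.1 i) :=
  tendsto_atTop.1 (h w) b

variable {h : ℝ} (H : GromovHyperbolic X h)
include H

lemma GromovHyperbolic.equivalence : Equivalence (@GromovEquiv X _) where
  refl x w := tendsto_atTop.2 fun b => by
    obtain ⟨N, hN⟩ := x.2.exists_le w b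
    filter_upwards [eventually_ge_atTop N] with i hi using hN i hi i hi
  symm hxy w := by simpa only [gromovProduct_comm w] using hxy w
  trans {x y z} hxy hyz w := tendsto_atTop.2 fun b => by
    filter_upwards [hxy.eventually_le w (b + h), hyz.eventually_le w (b + h)] with i h1 h2
    rcases H.le_or w (x.1 i) (y.1 i) (z.1 i) with h3 | h3 <;> linarith

lemma GromovHyperbolic.equiv_of_mk_eq {x y : GromovSeq X}
    (hxy : GromovBoundary.mk x = GromovBoundary.mk y) : GromovEquiv x y :=
  H.equivalence.eqvGen_iff.1 (Quot.eqvGen_exact hxy)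

lemma GromovHyperbolic.exists_le_of_equiv {x y : GromovSeq X} (hxy : GromovEquiv x y) (w : X)
    (b : ℝ) : ∃ N, ∀ i ≥ N, ∀ j ≥ N, b ≤ gromovProduct w (x.1 i) (y.1 j) := by
  obtain ⟨N, hN⟩ := x.2.exists_le w (b + h)
  obtain ⟨M, hM⟩ := eventually_atTop.1 (hxy.eventually_le w (b + h))
  refine ⟨max N M, fun i hi j hj => ?_⟩
  have h1 := hN i (le_trans (le_max_left _ _) hi) j (le_trans (le_max_left _ _) hj)
  have h2 := hM j (le_trans (le_max_right _ _) hj)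
  rcases H.le_or w (x.1 i) (x.1 j) (y.1 j) with h3 | h3 <;> linarith

/-! ### Gromov products of boundary points -/

omit H in
lemma boundaryGromovProduct_le_liminf (w : X) (x y : GromovSeq X) :
    boundaryGromovProduct w (GromovBoundary.mk x) (GromovBoundary.mk y) ≤
      liminf (fun i : ℕ => ((gromovProduct w (x.1 i) (y.1 i) : ℝ) : EReal)) atTop :=
  iInf_le_of_le x (iInf_le_of_le y (iInf_le_of_le rfl (iInf_le_of_le rfl le_rfl)))

omit H in
lemma le_boundaryGromovProduct {w : X} {ξ ζ : GromovBoundary X} {c : ℝ}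
    (hc : ∀ x y : GromovSeq X, GromovBoundary.mk x = ξ → GromovBoundary.mk y = ζ →
      ∀ᶠ i in atTop, c ≤ gromovProduct w (x.1 i) (y.1 i)) :
    (c : EReal) ≤ boundaryGromovProduct w ξ ζ := by
  refine le_iInf fun x => le_iInf fun y => le_iInf fun hx => le_iInf fun hy => ?_
  refine le_liminf_of_le (by isBoundedDefault) ?_
  filter_upwards [hc x y hx hy] with i hi using EReal.coe_le_coe_iff.2 hi

omit H in
lemma boundaryGromovProduct_nonneg (w : X) (ξ ζ : GromovBoundary X) :
    0 ≤ boundaryGromovProduct w ξ ζ :=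
  le_boundaryGromovProduct (c := 0) fun _ _ _ _ =>
    Eventually.of_forall fun _ => gromovProduct_nonneg _ _ _

omit H in
lemma eventually_lt_of_lt_boundaryGromovProduct {w : X} {x y : GromovSeq X} {c : ℝ}
    (hc : (c : EReal) < boundaryGromovProduct w (GromovBoundary.mk x) (GromovBoundary.mk y)) :
    ∀ᶠ i in atTop, c < gromovProduct w (x.1 i) (y.1 i) := by
  filter_upwards [eventually_lt_of_lt_liminf
    (hc.trans_le (boundaryGromovProduct_le_liminf w x y))] with i hi
  exact EReal.coe_lt_coe_iff.1 hi

omit H in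
lemma boundaryGromovProduct_le {w : X} {x y : GromovSeq X} {c : ℝ}
    (hc : ∃ᶠ i in atTop, gromovProduct w (x.1 i) (y.1 i) ≤ c) :
    boundaryGromovProduct w (GromovBoundary.mk x) (GromovBoundary.mk y) ≤ c := by
  by_contra hlt
  refine hc ?_
  filter_upwards [eventually_lt_of_lt_boundaryGromovProduct (not_le.1 hlt)] with i hi
  exact not_le.2 hi

/-- Gromov products along any two representatives are, up to `2h`, at most the Gromov product of
the boundary points. -/
lemma GromovHyperbolic.eventually_lt {w : X} {x y : GromovSeq X} {c : ℝ}
    (hc : boundaryGromovProduct w (GromovBoundary.mk x) (GromovBoundary.mk y) < c) :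
    ∀ᶠ i in atTop, gromovProduct w (x.1 i) (y.1 i) < c + 2 * h := by
  simp only [boundaryGromovProduct, iInf_lt_iff] at hc
  obtain ⟨x', y', hx, hy, hlt⟩ := hc
  have hfr := frequently_lt_of_liminf_lt (by isBoundedDefault) hlt
  obtain ⟨N, hN⟩ := H.exists_le_of_equiv (H.equiv_of_mk_eq hx) w (c + 2 * h)
  obtain ⟨M, hM⟩ := H.exists_le_of_equiv (H.equiv_of_mk_eq hy.symm) w (c + 2 * h)
  obtain ⟨i, hi, hlt⟩ := frequently_atTop.1 hfr (max N M)
  have hlt' := EReal.coe_lt_coe_iff.1 hlt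
  filter_upwards [eventually_ge_atTop (max N M)] with j hj
  have h1 := hN i (le_trans (le_max_left _ _) hi) j (le_trans (le_max_left _ _) hj)
  have h2 := hM j (le_trans (le_max_right _ _) hj) i (le_trans (le_max_right _ _) hi)
  rcases H.le_or_three w (x'.1 i) (x.1 j) (y.1 j) (y'.1 i) with h3 | h3 | h3 <;> linarith

lemma GromovHyperbolic.le_boundaryGromovProduct_of_frequently {w : X} {x y : GromovSeq X} {c : ℝ}
    (hc : ∃ᶠ i in atTop, c + 2 * h ≤ gromovProduct w (x.1 i) (y.1 i)) :
    (c : EReal) ≤ boundaryGromovProduct w (GromovBoundary.mk x) (GromovBoundary.mk y) := by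
  by_contra hlt
  refine hc ?_
  filter_upwards [H.eventually_lt (not_le.1 hlt)] with i hi
  exact not_le.2 hi

lemma GromovHyperbolic.boundary {w : X} {ξ η ζ : GromovBoundary X} {c : ℝ}
    (h1 : (c : EReal) < boundaryGromovProduct w ξ η)
    (h2 : (c : EReal) < boundaryGromovProduct w η ζ) :
    ((c - h : ℝ) : EReal) ≤ boundaryGromovProduct w ξ ζ := by
  refine le_boundaryGromovProduct ?_
  rintro x z rfl rfl
  obtain ⟨y, rfl⟩ := Quot.exists_rep η
  filter_upwards [eventually_lt_of_lt_boundaryGromovProduct (x := x) (y := y) h1,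
    eventually_lt_of_lt_boundaryGromovProduct (x := y) (y := z) h2] with i h3 h4
  rcases H.le_or w (x.1 i) (y.1 i) (z.1 i) with h5 | h5 <;> linarith

end Boundary

/-! ### Chains and visual metrics -/

/-- Frink's chain inequality. A nonnegative function satisfying the ultrametric inequality up to a
factor `K ≤ 2` is controlled by its sums along chains. The weights, `1` on the two outer links and
`2` on the inner ones, are what makes the induction close: the chain is cut at the last `p` for which
`ρ (c a) (c (b + 1)) ≤ K * ρ (c p) (c (b + 1))`, and the link from `p` to `p + 1` is shared by
both halves. -/
lemma chain_inequality {Y : Type*} {ρ : Y → Y → ℝ} {K : ℝ} (hK1 : 1 ≤ K) (hK2 : K ≤ 2)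
    (hρ : ∀ x y, 0 ≤ ρ x y) (hq : ∀ x y z, ρ x z ≤ K * max (ρ x y) (ρ y z)) (c : ℕ → Y)
    (n : ℕ) : ∀ a b : ℕ, a < b → b - a ≤ n →
      ρ (c a) (c (b + 1)) ≤ K * (2 * ∑ i ∈ Finset.Ico a (b + 1), ρ (c i) (c (i + 1)) -
        ρ (c a) (c (a + 1)) - ρ (c b) (c (b + 1))) := by
  induction n with
  | zero => intro a b hab hn; omega
  | succ n ih =>
    intro a b hab hn
    classical
    set E : ℕ → ℝ := fun i => ρ (c i) (c (i + 1)) with hE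
    have hE0 : ∀ i, 0 ≤ E i := fun i => hρ _ _
    have hsum : E a + E b ≤ ∑ i ∈ Finset.Ico a (b + 1), E i := by
      rw [Finset.sum_Ico_succ_top hab.le, Finset.sum_eq_sum_Ico_succ_bot hab]
      have : 0 ≤ ∑ i ∈ Finset.Ico (a + 1) b, E i := Finset.sum_nonneg fun i _ => hE0 i
      linarith
    set P : ℕ → Prop := fun p => ρ (c a) (c (b + 1)) ≤ K * ρ (c p) (c (b + 1)) with hP
    have hPa : P a := le_mul_of_one_le_left (hρ _ _) hK1
    set p := Nat.findGreatest P b with hp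
    have hPp : P p := Nat.findGreatest_spec hab.le hPa
    have hap : a ≤ p := Nat.le_findGreatest hab.le hPa
    have hpb : p ≤ b := Nat.findGreatest_le b
    rcases hpb.eq_or_lt with hpb | hpb
    · rw [hP, hpb] at hPp
      refine hPp.trans (mul_le_mul_of_nonneg_left ?_ (by linarith))
      change E b ≤ _
      change E b ≤ 2 * ∑ i ∈ Finset.Ico a (b + 1), E i - E a - E b
      linarith [hE0 a]
    · have hnot : ¬ P (p + 1) := Nat.findGreatest_is_greatest (Nat.lt_succ_self p) hpb
      have hle : ρ (c a) (c (b + 1)) ≤ K * ρ (c a) (c (p + 1)) := by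
        have h1 := hq (c a) (c (p + 1)) (c (b + 1))
        rcases max_choice (ρ (c a) (c (p + 1))) (ρ (c (p + 1)) (c (b + 1))) with e | e <;>
          rw [e] at h1
        · exact h1
        · exact absurd h1 hnot
      rcases hap.eq_or_lt with hap | hap
      · rw [← hap] at hle
        refine hle.trans (mul_le_mul_of_nonneg_left ?_ (by linarith))
        change E a ≤ 2 * ∑ i ∈ Finset.Ico a (b + 1), E i - E a - E b
        linarith [hE0 b]
      · have i1 := ih a p hap (by omega)
        have i2 := ih p b hpb (by omega)
        have hs : ∑ i ∈ Finset.Ico a (p + 1), E i + ∑ i ∈ Finset.Ico p (b + 1), E i =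
            ∑ i ∈ Finset.Ico a (b + 1), E i + E p := by
          rw [← Finset.sum_Ico_consecutive E hap.le (by omega : p ≤ b + 1),
            Finset.sum_Ico_succ_top hap.le]
          ring
        have hPp' : ρ (c a) (c (b + 1)) ≤ K * ρ (c p) (c (b + 1)) := hPp
        have m1 : K * ρ (c a) (c (p + 1)) ≤ 2 * ρ (c a) (c (p + 1)) :=
          mul_le_mul_of_nonneg_right hK2 (hρ _ _)
        have m2 : K * ρ (c p) (c (b + 1)) ≤ 2 * ρ (c p) (c (b + 1)) :=
          mul_le_mul_of_nonneg_right hK2 (hρ _ _)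
        calc ρ (c a) (c (b + 1)) ≤ ρ (c a) (c (p + 1)) + ρ (c p) (c (b + 1)) := by linarith
          _ ≤ K * (2 * ∑ i ∈ Finset.Ico a (p + 1), E i - E a - E p) +
              K * (2 * ∑ i ∈ Finset.Ico p (b + 1), E i - E p - E b) := add_le_add i1 i2
          _ = K * (2 * (∑ i ∈ Finset.Ico a (p + 1), E i + ∑ i ∈ Finset.Ico p (b + 1), E i) -
                2 * E p - E a - E b) := by ring
          _ = K * (2 * ∑ i ∈ Finset.Ico a (b + 1), E i - E a - E b) := by rw [hs]; ring

lemma le_four_mul_chain_sum {Y : Type*} {ρ : Y → Y → ℝ} {K : ℝ} (hK1 : 1 ≤ K) (hK2 : K ≤ 2)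
    (hρ : ∀ x y, 0 ≤ ρ x y) (hq : ∀ x y z, ρ x z ≤ K * max (ρ x y) (ρ y z)) (c : ℕ → Y)
    {n : ℕ} (hn : 1 ≤ n) :
    ρ (c 0) (c n) ≤ 4 * ∑ i ∈ Finset.range n, ρ (c i) (c (i + 1)) := by
  obtain ⟨b, rfl⟩ : ∃ b, n = b + 1 := ⟨n - 1, by omega⟩
  have hs : 0 ≤ ∑ i ∈ Finset.range (b + 1), ρ (c i) (c (i + 1)) :=
    Finset.sum_nonneg fun i _ => hρ _ _
  rcases Nat.eq_zero_or_pos b with rfl | hb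
  · simp only [zero_add, Finset.range_one, Finset.sum_singleton] at hs ⊢
    linarith
  · have := chain_inequality hK1 hK2 hρ hq c b 0 b hb (by omega)
    rw [← Finset.range_eq_Ico] at this
    have h1 := hρ (c 0) (c (0 + 1))
    have h2 := hρ (c b) (c (b + 1))
    nlinarith

section Visual

variable {X : Type*} [MetricSpace X] {w : X} {ε : ℝ} {ξ ζ : GromovBoundary X}

lemma visualRho_nonneg (w : X) (ε : ℝ) (ξ ζ : GromovBoundary X) : 0 ≤ visualRho w ε ξ ζ := by
  unfold visualRho
  split_ifs
  · exact le_rfl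
  · exact (Real.exp_pos _).le

lemma visualRho_le_iff (hε : 0 < ε) (c : ℝ) :
    visualRho w ε ξ ζ ≤ Real.exp (-ε * c) ↔ (c : EReal) ≤ boundaryGromovProduct w ξ ζ := by
  unfold visualRho
  have h0 := boundaryGromovProduct_nonneg w ξ ζ
  generalize boundaryGromovProduct w ξ ζ = p at h0 ⊢
  induction p using EReal.rec with
  | bot => simp at h0
  | top => simp [(Real.exp_pos _).le]
  | coe a => simp [hε]

lemma le_visualRho_iff (hε : 0 < ε) (c : ℝ) :
    Real.exp (-ε * c) ≤ visualRho w ε ξ ζ ↔ boundaryGromovProduct w ξ ζ ≤ c := by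
  unfold visualRho
  have h0 := boundaryGromovProduct_nonneg w ξ ζ
  generalize boundaryGromovProduct w ξ ζ = p at h0 ⊢
  induction p using EReal.rec with
  | bot => simp at h0
  | top => simp [Real.exp_pos]
  | coe a => simp [hε]

lemma exists_exp_neg_mul_eq (hε : 0 < ε) {r : ℝ} (hr : 0 < r) : ∃ c, Real.exp (-ε * c) = r :=
  ⟨-Real.log r / ε, by
    rw [show -ε * (-Real.log r / ε) = Real.log r by field_simp, Real.exp_log hr]⟩

lemma visualRho_quasi_ultrametric {h : ℝ} (H : GromovHyperbolic X h) (w : X) (hε : 0 < ε)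
    (ξ η ζ : GromovBoundary X) :
    visualRho w ε ξ ζ ≤ Real.exp (ε * h) * max (visualRho w ε ξ η) (visualRho w ε η ζ) := by
  rw [← div_le_iff₀' (Real.exp_pos _)]
  refine le_of_forall_gt_imp_ge_of_dense fun M hM => ?_
  obtain ⟨c, rfl⟩ := exists_exp_neg_mul_eq hε ((le_max_of_le_left (visualRho_nonneg _ _ _ _)).trans_lt hM)
  rw [max_lt_iff, ← not_le, ← not_le, le_visualRho_iff hε, le_visualRho_iff hε, not_le, not_le] at hM
  have := (visualRho_le_iff hε _).2 (H.boundary hM.1 hM.2)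
  rw [div_le_iff₀' (Real.exp_pos _), ← Real.exp_add]
  refine this.trans (le_of_eq ?_)
  congr 1; ring

lemma visualDist_le (w : X) (ε : ℝ) (ξ ζ : GromovBoundary X) :
    visualDist w ε ξ ζ ≤ visualRho w ε ξ ζ := by
  refine csInf_le ⟨0, ?_⟩ ⟨1, fun i => if i = 0 then ξ else ζ, le_rfl, by simp, by simp, by simp⟩
  rintro r ⟨n, c, -, -, -, rfl⟩
  exact Finset.sum_nonneg fun i _ => visualRho_nonneg _ _ _ _

lemma visualRho_le_four_mul {h : ℝ} (H : GromovHyperbolic X h) (w : X) (hε : 0 < ε)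
    (hεh : Real.exp (ε * h) ≤ 2) (ξ ζ : GromovBoundary X) :
    visualRho w ε ξ ζ ≤ 4 * visualDist w ε ξ ζ := by
  have h1 : 1 ≤ Real.exp (ε * h) :=
    Real.one_le_exp (mul_nonneg hε.le (haveI : Nonempty X := ⟨w⟩; H.nonneg))
  rw [← div_le_iff₀' (by norm_num : (0 : ℝ) < 4)]
  refine le_csInf ⟨_, 1, fun i => if i = 0 then ξ else ζ, le_rfl, by simp, by simp, rfl⟩ ?_
  rintro r ⟨n, c, hn, rfl, rfl, rfl⟩
  rw [div_le_iff₀' (by norm_num : (0 : ℝ) < 4)]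
  exact le_four_mul_chain_sum h1 hεh (visualRho_nonneg w ε)
    (visualRho_quasi_ultrametric H w hε) c hn

/-- Uniform perfectness in terms of Gromov products: seen from any `ξ`, every window of length `A`
beyond `t₀` contains a Gromov product `(ξ|ζ)_w`. -/
def ProductsRelativelyDense (w : X) : Prop :=
  ∃ A t₀ : ℝ, 0 ≤ A ∧ 0 ≤ t₀ ∧ ∀ (ξ : GromovBoundary X) (t : ℝ), t₀ ≤ t →
    ∃ ζ, (t : EReal) ≤ boundaryGromovProduct w ξ ζ ∧ boundaryGromovProduct w ξ ζ ≤ (t + A : ℝ)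

lemma uniformlyPerfect_visualDist_iff {h : ℝ} (H : GromovHyperbolic X h) (w : X) (hε : 0 < ε)
    (hεh : Real.exp (ε * h) ≤ 2) :
    UniformlyPerfect (visualDist w ε) ↔ ProductsRelativelyDense w := by
  constructor
  · rintro ⟨S, hS, r₀, hr₀, hup⟩
    obtain ⟨t₀, ht₀⟩ := exists_exp_neg_mul_eq hε (show 0 < 4 * r₀ by linarith)
    obtain ⟨A, hA⟩ := exists_exp_neg_mul_eq hε (show 0 < 1 / (4 * S) by positivity)
    have hA0 : 0 ≤ A := by
      by_contra hneg
      have h1 : 1 < Real.exp (-ε * A) := Real.one_lt_exp_iff.2 (by nlinarith)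
      rw [hA, lt_div_iff₀ (by linarith)] at h1
      linarith
    refine ⟨A, max t₀ 0, hA0, le_max_right _ _, fun ξ t ht => ?_⟩
    have hle : Real.exp (-ε * t) ≤ 4 * r₀ := by
      rw [← ht₀]
      exact Real.exp_le_exp.2 (by nlinarith [le_max_left t₀ 0])
    obtain ⟨ζ, h1, h2⟩ := hup ξ (Real.exp (-ε * t) / 4) (by positivity) (by linarith)
    refine ⟨ζ, (visualRho_le_iff hε t).1 ?_, (le_visualRho_iff hε _).1 ?_⟩
    · linarith [visualRho_le_four_mul H w hε hεh ξ ζ]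
    · refine le_trans (le_of_eq ?_) (h1.le.trans (visualDist_le w ε ξ ζ))
      rw [mul_add, Real.exp_add, hA]
      field_simp
  · rintro ⟨A, t₀, hA, ht₀, hd⟩
    refine ⟨8 * Real.exp (ε * A), ?_, Real.exp (-ε * t₀), Real.exp_pos _, fun ξ r hr hr₀ => ?_⟩
    · linarith [Real.one_le_exp (mul_nonneg hε.le hA)]
    · obtain ⟨t, rfl⟩ := exists_exp_neg_mul_eq hε hr
      obtain ⟨ζ, h1, h2⟩ := hd ξ t (by
        have := Real.exp_le_exp.1 hr₀
        nlinarith)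
      refine ⟨ζ, ?_, (visualDist_le w ε ξ ζ).trans ((visualRho_le_iff hε t).2 h1)⟩
      have h3 := (le_visualRho_iff hε _).2 h2
      have h4 := visualRho_le_four_mul H w hε hεh ξ ζ
      rw [div_lt_iff₀ (by positivity)]
      have h5 : Real.exp (-ε * t) = Real.exp (-ε * (t + A)) * Real.exp (ε * A) := by
        rw [← Real.exp_add]; congr 1; ring
      rw [h5]
      have h6 : Real.exp (-ε * (t + A)) < visualDist w ε ξ ζ * 8 := by
        linarith [Real.exp_pos (-ε * (t + A))]
      calc _ < visualDist w ε ξ ζ * 8 * Real.exp (ε * A) :=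
            mul_lt_mul_of_pos_right h6 (Real.exp_pos _)
        _ = _ := by ring

end Visual

/-! ### Stability of quasi-geodesics -/

section Morse

variable {X : Type*} [MetricSpace X]

/-- `g` restricted to `[0, ℓ]` is a quasi-geodesic; it need not be continuous. -/
def IsQuasiGeodesic (K C ℓ : ℝ) (g : ℝ → X) : Prop :=
  ∀ s ∈ Set.Icc 0 ℓ, ∀ t ∈ Set.Icc 0 ℓ,
    dist (g s) (g t) ≤ K * |s - t| + C ∧ |s - t| ≤ K * (dist (g s) (g t) + C)

/-- Geodesics diverge exponentially: a point of a geodesic joining two points of a coarse path is at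
distance at most logarithmic in the length of the path from the path. Proved by halving the
parameter interval. -/
lemma exists_dist_le_of_le_two_pow (hgeo : IsGeodesicSpace X) {δ : ℝ} (hhyp : IsDeltaHyperbolic X δ)
    {K C ℓ : ℝ} (hK : 1 ≤ K) {g : ℝ → X} (hg : IsQuasiGeodesic K C ℓ g) (k : ℕ) :
    ∀ s t : ℝ, 0 ≤ s → s ≤ t → t ≤ ℓ → t - s ≤ 2 ^ k → ∀ a, IsGeodesicSegment (g s) (g t) a →
      ∀ p ∈ a, ∃ r ∈ Set.Icc s t, dist p (g r) ≤ k * δ + K + C := by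
  induction k with
  | zero =>
    intro s t h0 hst ht hk a ha p hp
    refine ⟨s, ⟨le_rfl, hst⟩, ?_⟩
    have h1 := ha.dist_add hp
    have h2 := (hg s ⟨h0, hst.trans ht⟩ t ⟨h0.trans hst, ht⟩).1
    rw [abs_sub_comm, abs_of_nonneg (by linarith)] at h2
    rw [pow_zero] at hk
    have h3 : K * (t - s) ≤ K * 1 := mul_le_mul_of_nonneg_left hk (by linarith)
    rw [dist_comm]
    push_cast
    linarith [dist_nonneg (x := p) (y := g t)]
  | succ k ih =>
    intro s t h0 hst ht hk a ha p hp
    rw [pow_succ] at hk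
    obtain ⟨b, hb⟩ := hgeo (g t) (g ((s + t) / 2))
    obtain ⟨c, hc⟩ := hgeo (g ((s + t) / 2)) (g s)
    obtain ⟨q, hq, hpq⟩ := hhyp _ _ _ a b c ha hb hc p hp
    rcases hq with hq | hq
    · obtain ⟨r, hr, hqr⟩ := ih ((s + t) / 2) t (by linarith) (by linarith) ht (by linarith) b
        hb.symm q hq
      refine ⟨r, ⟨by linarith [hr.1], hr.2⟩, ?_⟩
      push_cast
      linarith [dist_triangle p q (g r)]
    · obtain ⟨r, hr, hqr⟩ := ih s ((s + t) / 2) h0 (by linarith) (by linarith) (by linarith) c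
        hc.symm q hq
      refine ⟨r, ⟨hr.1, by linarith [hr.2]⟩, ?_⟩
      push_cast
      linarith [dist_triangle p q (g r)]

lemma eventually_add_mul_le_two_pow (a b : ℝ) : ∀ᶠ n : ℕ in atTop, a + b * n ≤ 2 ^ n := by
  have h1 := (isLittleO_pow_const_const_pow_of_one_lt (R := ℝ) 1
    (by norm_num : (1 : ℝ) < 2)).def (show 0 < 1 / (2 * (|b| + 1)) by positivity)
  have h2 := (tendsto_pow_atTop_atTop_of_one_lt (by norm_num : (1 : ℝ) < 2)).eventually_ge_atTop
    (2 * a)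
  filter_upwards [h1, h2] with n h3 h4
  simp only [pow_one, Real.norm_eq_abs, Nat.abs_cast] at h3
  rw [abs_of_nonneg (by positivity : (0 : ℝ) ≤ 2 ^ n), div_mul_eq_mul_div, one_mul,
    le_div_iff₀ (by positivity)] at h3
  have h5 : b * n ≤ |b| * n := mul_le_mul_of_nonneg_right (le_abs_self b) (by positivity)
  have h6 : (0 : ℝ) ≤ n := by positivity
  linarith

/-- Linear against exponential growth: a number bounded by the logarithm of a linear function of
itself is bounded. -/
lemma exists_bound_of_log_bound {δ K C : ℝ} (hδ : 0 < δ) (hK : 1 ≤ K) : ∃ B : ℝ, ∀ D : ℝ,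
    (∀ k : ℕ, K * (6 * D + 6 + C) ≤ 2 ^ k → D ≤ (2 + k) * δ + K + C) → D ≤ B := by
  obtain ⟨k₀, hk₀⟩ := eventually_atTop.1 (eventually_add_mul_le_two_pow
    (K * (6 * (3 * δ + K + C) + 6 + C)) (K * (6 * δ)))
  refine ⟨(3 + k₀) * δ + K + C, fun D hD => ?_⟩
  by_contra hlt
  rw [not_le] at hlt
  have h1 : 3 + (k₀ : ℝ) < (D - K - C) / δ := by rw [lt_div_iff₀ hδ]; linarith
  have h2 := Nat.le_ceil ((D - K - C) / δ)
  have h3 := Nat.ceil_lt_add_one (show 0 ≤ (D - K - C) / δ by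
    linarith [show (0 : ℝ) ≤ k₀ by positivity])
  set m := ⌈(D - K - C) / δ⌉₊
  have h4 : k₀ + 3 < m := by
    have : ((k₀ + 3 : ℕ) : ℝ) < m := by push_cast; linarith
    exact_mod_cast this
  obtain ⟨k, hmk⟩ : ∃ k, m = k + 3 := ⟨m - 3, by omega⟩
  rw [hmk] at h2 h3 h4
  push_cast at h2 h3
  rw [div_le_iff₀ hδ] at h2
  have h5 : (2 + (k : ℝ)) * δ < D - K - C := by
    rw [← lt_div_iff₀ hδ]; linarith
  have h6 := hk₀ k (by omega)
  have h7 := hD k (by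
    refine le_trans ?_ h6
    have : K * (6 * D + 6 + C) ≤ K * (6 * ((k + 3) * δ + K + C) + 6 + C) :=
      mul_le_mul_of_nonneg_left (by linarith) (by linarith)
    linarith)
  linarith

/-- A geodesic with the same end points as a quasi-geodesic lies in a bounded neighbourhood of it.
At a point of the geodesic at maximal distance `D` from the quasi-geodesic, compare with the part of
the quasi-geodesic that bypasses the ball of radius `D` at that point. -/
theorem exists_geodesic_near_quasiGeodesic (hgeo : IsGeodesicSpace X) {δ : ℝ} (hδ : 0 < δ)
    (hhyp : IsDeltaHyperbolic X δ) {K : ℝ} (hK : 1 ≤ K) {C : ℝ} (hC : 0 ≤ C) :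
    ∃ D : ℝ, 0 ≤ D ∧ ∀ (ℓ : ℝ) (g : ℝ → X), 0 ≤ ℓ → IsQuasiGeodesic K C ℓ g →
      ∀ a, IsGeodesicSegment (g 0) (g ℓ) a → ∀ p ∈ a, ∃ r ∈ Set.Icc 0 ℓ, dist p (g r) ≤ D := by
  obtain ⟨B, hB⟩ := exists_bound_of_log_bound (C := C) hδ hK
  refine ⟨max (B + 1) 0, le_max_right _ _, fun ℓ g hℓ hg a ha p hp => ?_⟩
  set G := g '' Set.Icc 0 ℓ with hG
  have hGne : G.Nonempty := ⟨g 0, 0, ⟨le_rfl, hℓ⟩, rfl⟩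
  obtain ⟨p₀, hp₀, hmax⟩ := ha.isCompact.exists_isMaxOn ⟨p, hp⟩
    (Metric.continuous_infDist_pt G).continuousOn
  set D := Metric.infDist p₀ G with hD
  have hD0 : 0 ≤ D := Metric.infDist_nonneg
  have near : ∀ q ∈ a, ∀ E, D < E → ∃ r ∈ Set.Icc 0 ℓ, dist q (g r) < E := fun q hq E hE => by
    obtain ⟨-, ⟨r, hr, rfl⟩, h⟩ := (Metric.infDist_lt_iff hGne).1 ((hmax hq).trans_lt hE)
    exact ⟨r, hr, h⟩
  have far : ∀ r ∈ Set.Icc 0 ℓ, D ≤ dist p₀ (g r) := fun r hr =>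
    Metric.infDist_le_dist_of_mem ⟨r, hr, rfl⟩
  suffices hDB : D ≤ B by
    obtain ⟨r, hr, h⟩ := near p hp (B + 1) (by linarith)
    exact ⟨r, hr, h.le.trans (le_max_left _ _)⟩
  refine hB D fun k hk => ?_
  obtain ⟨σ, h0, h1, h2, rfl⟩ := ha
  have hσ : IsGeodesicPath (g 0) (g ℓ) σ := ⟨h0, h1, h2⟩
  obtain ⟨τ, hτ, rfl⟩ := hp₀
  -- The short connections between geodesic and quasi-geodesic stay away from `σ τ`.
  have far' : ∀ (y : X) (r : ℝ), r ∈ Set.Icc 0 ℓ →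
      (y = g r ∨ dist (σ τ) y = 2 * (D + 1) ∧ dist y (g r) ≤ D + 1) →
      ∀ s, IsGeodesicSegment y (g r) s → ∀ q ∈ s, D ≤ dist (σ τ) q := by
    rintro y r hr (rfl | ⟨hy1, hy2⟩) s hs q hq
    · have e := hs.dist_add hq
      rw [dist_self] at e
      have : dist (g r) q = 0 := by
        linarith [dist_nonneg (x := g r) (y := q), dist_nonneg (x := q) (y := g r)]
      rw [← dist_eq_zero.1 this]
      exact far r hr
    · have e := hs.dist_add hq
      have := dist_triangle (σ τ) q y
      rw [dist_comm q y] at this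
      linarith [dist_nonneg (x := q) (y := g r)]
  have left : ∃ s ∈ Set.Icc 0 τ, ∃ r ∈ Set.Icc 0 ℓ,
      (σ s = g r ∨ dist (σ τ) (σ s) = 2 * (D + 1) ∧ dist (σ s) (g r) ≤ D + 1) ∧
      dist (σ τ) (σ s) ≤ 2 * (D + 1) := by
    rcases le_total τ (2 * (D + 1)) with h | h
    · refine ⟨0, ⟨le_rfl, hτ.1⟩, 0, ⟨le_rfl, hℓ⟩, Or.inl h0, ?_⟩
      rw [h2 τ hτ 0 ⟨le_rfl, dist_nonneg⟩, abs_of_nonneg (by linarith [hτ.1])]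
      linarith
    · have hm : τ - 2 * (D + 1) ∈ Set.Icc 0 (dist (g 0) (g ℓ)) :=
        ⟨by linarith, by linarith [hτ.2]⟩
      obtain ⟨r, hr, hd⟩ := near (σ (τ - 2 * (D + 1))) ⟨_, hm, rfl⟩ (D + 1) (by linarith)
      have e : dist (σ τ) (σ (τ - 2 * (D + 1))) = 2 * (D + 1) := by
        rw [h2 τ hτ _ hm, abs_of_nonneg (by linarith)]; ring
      exact ⟨_, ⟨hm.1, by linarith⟩, r, hr, Or.inr ⟨e, hd.le⟩, e.le⟩
  have right : ∃ s ∈ Set.Icc τ (dist (g 0) (g ℓ)), ∃ r ∈ Set.Icc 0 ℓ,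
      (σ s = g r ∨ dist (σ τ) (σ s) = 2 * (D + 1) ∧ dist (σ s) (g r) ≤ D + 1) ∧
      dist (σ τ) (σ s) ≤ 2 * (D + 1) := by
    rcases le_total (dist (g 0) (g ℓ)) (τ + 2 * (D + 1)) with h | h
    · refine ⟨_, ⟨hτ.2, le_rfl⟩, ℓ, ⟨hℓ, le_rfl⟩, Or.inl h1, ?_⟩
      rw [h2 τ hτ _ ⟨dist_nonneg, le_rfl⟩, abs_sub_comm, abs_of_nonneg (by linarith [hτ.2])]
      linarith
    · have hm : τ + 2 * (D + 1) ∈ Set.Icc 0 (dist (g 0) (g ℓ)) :=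
        ⟨by linarith [hτ.1], by linarith⟩
      obtain ⟨r, hr, hd⟩ := near (σ (τ + 2 * (D + 1))) ⟨_, hm, rfl⟩ (D + 1) (by linarith)
      have e : dist (σ τ) (σ (τ + 2 * (D + 1))) = 2 * (D + 1) := by
        rw [h2 τ hτ _ hm, abs_sub_comm, abs_of_nonneg (by linarith)]; ring
      exact ⟨_, ⟨by linarith, hm.2⟩, r, hr, Or.inr ⟨e, hd.le⟩, e.le⟩
  obtain ⟨s₁, hs₁, r₁, hr₁, hc₁, hd₁⟩ := left
  obtain ⟨s₂, hs₂, r₂, hr₂, hc₂, hd₂⟩ := right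
  have hshort : ∀ {y : X} {r : ℝ},
      (y = g r ∨ dist (σ τ) y = 2 * (D + 1) ∧ dist y (g r) ≤ D + 1) → dist y (g r) ≤ D + 1 := by
    rintro y r (rfl | h)
    · rw [dist_self]; linarith
    · exact h.2
  have hgg : dist (g r₁) (g r₂) ≤ 6 * D + 6 := by
    have t1 := dist_triangle4 (g r₁) (σ s₁) (σ s₂) (g r₂)
    have t2 := dist_triangle_left (σ s₁) (σ s₂) (σ τ)
    rw [dist_comm (g r₁) (σ s₁)] at t1
    linarith [hshort hc₁, hshort hc₂]
  have hrr : |r₁ - r₂| ≤ 2 ^ k := by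
    refine ((hg r₁ hr₁ r₂ hr₂).2.trans ?_).trans hk
    exact mul_le_mul_of_nonneg_left (by linarith) (by linarith)
  have hlog : ∀ e, IsGeodesicSegment (g r₁) (g r₂) e → ∀ q ∈ e,
      ∃ r ∈ Set.Icc 0 ℓ, dist q (g r) ≤ k * δ + K + C := by
    intro e he q hq
    rcases le_total r₁ r₂ with hle | hle
    · rw [abs_sub_comm, abs_of_nonneg (by linarith)] at hrr
      obtain ⟨r, hr, h⟩ := exists_dist_le_of_le_two_pow hgeo hhyp hK hg k r₁ r₂ hr₁.1 hle hr₂.2 hrr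
        e he q hq
      exact ⟨r, ⟨hr₁.1.trans hr.1, hr.2.trans hr₂.2⟩, h⟩
    · rw [abs_of_nonneg (by linarith)] at hrr
      obtain ⟨r, hr, h⟩ := exists_dist_le_of_le_two_pow hgeo hhyp hK hg k r₂ r₁ hr₂.1 hle hr₁.2 hrr
        e he.symm q hq
      exact ⟨r, ⟨hr₂.1.trans hr.1, hr.2.trans hr₁.2⟩, h⟩
  have hsub := hσ.sub hs₁.1 (hs₁.2.trans hs₂.1) hs₂.2
  have hdist : dist (σ s₁) (σ s₂) = s₂ - s₁ := by
    rw [h2 s₁ ⟨hs₁.1, hs₁.2.trans hτ.2⟩ s₂ ⟨hτ.1.trans hs₂.1, hs₂.2⟩, abs_sub_comm,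
      abs_of_nonneg (by linarith [hs₁.2, hs₂.1])]
  have hmem : σ τ ∈ (fun t => σ (s₁ + t)) '' Set.Icc 0 (dist (σ s₁) (σ s₂)) :=
    ⟨τ - s₁, ⟨by linarith [hs₁.2], by rw [hdist]; linarith [hs₂.1]⟩, by simp⟩
  obtain ⟨b, hb⟩ := hgeo (σ s₂) (g r₂)
  obtain ⟨c, hc⟩ := hgeo (g r₂) (σ s₁)
  obtain ⟨d, hd⟩ := hgeo (σ s₁) (g r₁)
  obtain ⟨e, he⟩ := hgeo (g r₁) (g r₂)
  have hkδ : 0 ≤ k * δ := by positivity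
  obtain ⟨q, hq | hq, hpq⟩ := hhyp _ _ _ _ b c hsub.segment hb hc _ hmem
  · have := far' _ r₂ hr₂ hc₂ b hb q hq
    linarith
  · obtain ⟨q', hq' | hq', hqq'⟩ := hhyp _ _ _ c d e hc hd he q hq
    · have := far' _ r₁ hr₁ hc₁ d hd q' hq'
      linarith [dist_triangle (σ τ) q q']
    · obtain ⟨r, hr, h⟩ := hlog e he q' hq'
      have := far r hr
      linarith [dist_triangle4 (σ τ) q q' (g r)]

/-- A quasi-geodesic lies in a bounded neighbourhood of a geodesic with the same end points. -/
theorem exists_quasiGeodesic_near_geodesic (hgeo : IsGeodesicSpace X) {δ : ℝ} (hδ : 0 < δ)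
    (hhyp : IsDeltaHyperbolic X δ) {K : ℝ} (hK : 1 ≤ K) {C : ℝ} (hC : 0 ≤ C) :
    ∃ D : ℝ, ∀ (ℓ : ℝ) (g : ℝ → X), 0 ≤ ℓ → IsQuasiGeodesic K C ℓ g →
      ∀ a, IsGeodesicSegment (g 0) (g ℓ) a → ∀ t ∈ Set.Icc 0 ℓ, ∃ p ∈ a, dist (g t) p ≤ D := by
  obtain ⟨D, hD0, hD⟩ := exists_geodesic_near_quasiGeodesic hgeo hδ hhyp hK hC
  refine ⟨K * (K * (2 * D + 2 + C)) + C + D, fun ℓ g hℓ hg a ha t ht => ?_⟩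
  have hnear := hD ℓ g hℓ hg a ha
  obtain ⟨σ, h0, h1, h2, rfl⟩ := ha
  set m := dist (g 0) (g ℓ)
  have hm : 0 ≤ m := dist_nonneg
  -- Parameters of points near the part of the quasi-geodesic before `t`. Around the supremum there
  -- is a point near the part before `t` and one near the part after `t`.
  set U : Set ℝ := {τ | τ ∈ Set.Icc 0 m ∧ ∃ r ∈ Set.Icc 0 t, dist (σ τ) (g r) ≤ D} with hU
  have hU0 : (0 : ℝ) ∈ U := ⟨⟨le_rfl, hm⟩, 0, ⟨le_rfl, ht.1⟩, by rw [h0, dist_self]; exact hD0⟩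
  have hUb : BddAbove U := ⟨m, fun τ hτ => hτ.1.2⟩
  obtain ⟨τ₁, hτ₁, hlt⟩ := exists_lt_of_lt_csSup ⟨0, hU0⟩ (show sSup U - 1 < sSup U by linarith)
  have hle₁ := le_csSup hUb hτ₁
  have hsm : sSup U ≤ m := csSup_le ⟨0, hU0⟩ fun τ hτ => hτ.1.2
  obtain ⟨hτ₁m, r₁, hr₁, hd₁⟩ := hτ₁
  have hafter : ∃ τ₂ ∈ Set.Icc 0 m, |τ₁ - τ₂| ≤ 2 ∧ ∃ r₂ ∈ Set.Icc t ℓ, dist (σ τ₂) (g r₂) ≤ D := by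
    rcases le_or_gt m (sSup U + 1) with h | h
    · refine ⟨m, ⟨hm, le_rfl⟩, ?_, ℓ, ⟨ht.2, le_rfl⟩, by rw [h1, dist_self]; exact hD0⟩
      rw [abs_le]; constructor <;> linarith [hτ₁m.2]
    · have hmem : sSup U + 1 ∈ Set.Icc 0 m := ⟨by linarith [hτ₁m.1], h.le⟩
      obtain ⟨r₂, hr₂, hd₂⟩ := hnear (σ (sSup U + 1)) ⟨_, hmem, rfl⟩
      refine ⟨_, hmem, ?_, r₂, ⟨?_, hr₂.2⟩, hd₂⟩
      · rw [abs_le]; constructor <;> linarith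
      · by_contra hlt'
        have : sSup U + 1 ∈ U := ⟨hmem, r₂, ⟨hr₂.1, (not_le.1 hlt').le⟩, hd₂⟩
        linarith [le_csSup hUb this]
  obtain ⟨τ₂, hτ₂, hττ, r₂, hr₂, hd₂⟩ := hafter
  have hr₁' : r₁ ∈ Set.Icc 0 ℓ := ⟨hr₁.1, hr₁.2.trans ht.2⟩
  have hr₂' : r₂ ∈ Set.Icc 0 ℓ := ⟨ht.1.trans hr₂.1, hr₂.2⟩
  have hgg : dist (g r₁) (g r₂) ≤ 2 * D + 2 := by
    have t1 := dist_triangle4 (g r₁) (σ τ₁) (σ τ₂) (g r₂)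
    rw [dist_comm (g r₁) (σ τ₁), h2 _ hτ₁m _ hτ₂] at t1
    linarith
  have hrr : r₂ - r₁ ≤ K * (2 * D + 2 + C) := by
    have h3 := (hg r₁ hr₁' r₂ hr₂').2
    rw [abs_sub_comm] at h3
    exact ((le_abs_self _).trans h3).trans
      (mul_le_mul_of_nonneg_left (by linarith) (by linarith))
  refine ⟨σ τ₁, ⟨_, hτ₁m, rfl⟩, ?_⟩
  have h4 := (hg t ht r₁ hr₁').1
  rw [abs_of_nonneg (by linarith [hr₁.2])] at h4
  have h5 : K * (t - r₁) ≤ K * (K * (2 * D + 2 + C)) :=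
    mul_le_mul_of_nonneg_left (by linarith [hr₂.1]) (by linarith)
  have h6 := dist_triangle (g t) (g r₁) (σ τ₁)
  rw [dist_comm (g r₁)] at h6
  linarith

/-- A quasi-isometry keeps small Gromov products small. -/
theorem exists_gromovProduct_map_le (hgeo : IsGeodesicSpace X) {δ : ℝ} (hδ : 0 < δ)
    (hhyp : IsDeltaHyperbolic X δ) {f : X → X} (hf : IsQuasiIsometry f) (D : ℝ) :
    ∃ D' : ℝ, ∀ p x y : X, gromovProduct p x y ≤ D → gromovProduct (f p) (f x) (f y) ≤ D' := by
  obtain ⟨K, C, hK, hC, hf, -⟩ := hf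
  obtain ⟨E, hE⟩ := exists_quasiGeodesic_near_geodesic hgeo hδ hhyp hK hC
  refine ⟨K * (D + 2 * δ) + C + E, fun p x y hp => ?_⟩
  obtain ⟨σ, hσ⟩ := hgeo.exists_path x y
  obtain ⟨-, ⟨t, ht, rfl⟩, hq⟩ := exists_mem_dist_le hgeo hhyp hσ.segment p
  have hqg : IsQuasiGeodesic K C (dist x y) (fun t => f (σ t)) := by
    intro s hs t ht
    have h1 := hf (σ s) (σ t)
    rw [hσ.2.2 s hs t ht] at h1
    refine ⟨h1.2, ?_⟩
    have h2 : K⁻¹ * |s - t| ≤ dist (f (σ s)) (f (σ t)) + C := by linarith [h1.1]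
    rwa [inv_mul_le_iff₀ (by linarith)] at h2
  obtain ⟨a, ha⟩ := hgeo (f x) (f y)
  obtain ⟨q, hqa, hd⟩ := hE (dist x y) _ dist_nonneg hqg a
    (by simpa only [hσ.1, hσ.2.1] using ha) t ht
  have h1 := gromovProduct_le_dist_of_mem ha hqa (f p)
  have h2 := dist_triangle (f p) (f (σ t)) q
  have h3 := (hf p (σ t)).2
  have h4 : K * dist p (σ t) ≤ K * (D + 2 * δ) :=
    mul_le_mul_of_nonneg_left (by linarith) (by linarith)
  linarith

end Morse

/-! ### Poles -/

section Pole

variable {X : Type*} [MetricSpace X]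

/-- A reformulation of the existence of a pole without geodesic rays: every point `z` lies, up to a
bounded error, on the way from `w` to some boundary point. -/
lemma HasPole.exists_gromovSeq (hpole : HasPole X) {h : ℝ} (H : GromovHyperbolic X h) (w : X) :
    ∃ L : ℝ, 0 ≤ L ∧ ∀ z : X, ∃ y : GromovSeq X,
      ∀ᶠ j in atTop, dist z w - L ≤ gromovProduct w z (y.1 j) := by
  have h0 : 0 ≤ h := haveI : Nonempty X := ⟨w⟩; H.nonneg
  obtain ⟨L, hL, o | ξ, ho⟩ := hpole
  · refine ⟨L + dist o w, by positivity, fun z => ?_⟩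
    obtain ⟨v, s, ⟨γ, hγ0, hγ, ⟨hseq, -⟩, rfl⟩, p, ⟨t, ht, rfl⟩, hp⟩ := ho z
    refine ⟨⟨_, hseq⟩, ?_⟩
    filter_upwards [eventually_ge_atTop ⌈t⌉₊] with n hn
    have hn' : t ≤ n := Nat.ceil_le.1 hn
    have ht0 : 0 ≤ t := ht
    have e1 := hγ t ht n (ht0.trans hn')
    have e2 := hγ 0 (Set.mem_Ici.2 le_rfl) n (ht0.trans hn')
    have e3 := hγ 0 (Set.mem_Ici.2 le_rfl) t ht
    rw [abs_sub_comm, abs_of_nonneg (by linarith)] at e1 e2 e3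
    rw [hγ0] at e2 e3
    have t1 := dist_triangle z (γ t) (γ n)
    have t2 := dist_triangle o w (γ n)
    have t3 := dist_triangle4 z (γ t) o w
    rw [dist_comm (γ t) o] at t3
    rw [dist_comm w] at t2
    simp only [gromovProduct]
    linarith
  · refine ⟨2 * L + h, by positivity, fun z => ?_⟩
    obtain ⟨v, s, ⟨γ, hγ, ⟨hseq', -⟩, ⟨hseq, -⟩, rfl⟩, p, ⟨t, rfl⟩, hp⟩ := ho z
    -- Seen from `p = γ t`, the point `w` lies off the direction of one of the two ends of `γ`.
    have hone : ∀ n : ℕ, |t| ≤ n → gromovProduct (γ t) (γ n) w ≤ h ∨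
        gromovProduct (γ t) (γ (-(n : ℝ))) w ≤ h := by
      intro n hn
      have h1 := H.le_or (γ t) (γ n) w (γ (-(n : ℝ)))
      have h2 : gromovProduct (γ t) (γ n) (γ (-(n : ℝ))) = 0 := by
        have := abs_le.1 hn
        simp only [gromovProduct, hγ]
        rw [abs_of_nonneg (by linarith), abs_of_nonpos (by linarith), abs_of_nonneg (by linarith)]
        ring
      rw [h2, zero_add, gromovProduct_comm (γ t) w] at h1
      exact h1
    have hmono : ∀ n m : ℕ, |t| ≤ n → n ≤ m →
        gromovProduct (γ t) (γ n) w ≤ gromovProduct (γ t) (γ m) w := by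
      intro n m hn hnm
      have hnm' : (n : ℝ) ≤ m := by exact_mod_cast hnm
      have := abs_le.1 hn
      have t1 := dist_triangle (γ m) (γ n) w
      simp only [gromovProduct, hγ] at t1 ⊢
      rw [abs_of_nonneg (by linarith)] at t1 ⊢
      rw [abs_of_nonneg (by linarith)]
      linarith
    have hfin : ∀ q : X, gromovProduct (γ t) q w ≤ h →
        dist z w - (2 * L + h) ≤ gromovProduct w z q := by
      intro q hq
      have t1 := dist_triangle z (γ t) q
      have t2 := dist_triangle z (γ t) w
      simp only [gromovProduct] at hq ⊢
      rw [dist_comm q (γ t), dist_comm w (γ t)] at hq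
      linarith
    by_cases hex : ∃ n : ℕ, |t| ≤ n ∧ h < gromovProduct (γ t) (γ n) w
    · obtain ⟨n, hn, hlt⟩ := hex
      refine ⟨⟨_, hseq'⟩, ?_⟩
      filter_upwards [eventually_ge_atTop n] with m hm
      refine hfin _ ((hone m (hn.trans (by exact_mod_cast hm))).resolve_left ?_)
      exact not_le.2 (hlt.trans_le (hmono n m hn hm))
    · push Not at hex
      refine ⟨⟨_, hseq⟩, ?_⟩
      filter_upwards [eventually_ge_atTop ⌈|t|⌉₊] with n hn
      exact hfin _ (hex n (Nat.ceil_le.1 hn))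

/-! ### Uniform perfectness implies rigidity -/

/-- Every point far from `w` is a quasi-centre of three boundary points. -/
lemma exists_quasi_center (hpole : HasPole X) {h : ℝ} (H : GromovHyperbolic X h) {w : X}
    (hd : ProductsRelativelyDense w) :
    ∃ C R : ℝ, ∀ p : X, R ≤ dist p w → ∃ a b c : GromovSeq X, ∀ᶠ i in atTop,
      gromovProduct p (a.1 i) (b.1 i) ≤ C ∧ gromovProduct p (b.1 i) (c.1 i) ≤ C ∧
        gromovProduct p (c.1 i) (a.1 i) ≤ C := by
  have h0 : 0 ≤ h := haveI : Nonempty X := ⟨w⟩; H.nonneg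
  obtain ⟨L, hL, hpole⟩ := hpole.exists_gromovSeq H w
  obtain ⟨A, t₀, hA, ht₀, hd⟩ := hd
  refine ⟨t₀ + A + 6 * h + 2 * L + 3, t₀ + A + 4 * h + 3, fun p hp => ?_⟩
  obtain ⟨a, ha⟩ := hpole p
  obtain ⟨ζ₁, hζ₁, hζ₁'⟩ := hd (GromovBoundary.mk a) (dist p w) (by linarith)
  obtain ⟨ζ₂, hζ₂, hζ₂'⟩ := hd (GromovBoundary.mk a) t₀ le_rfl
  obtain ⟨b, rfl⟩ := Quot.exists_rep ζ₁
  obtain ⟨c, rfl⟩ := Quot.exists_rep ζ₂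
  have hb : ∀ᶠ i in atTop, dist p w - 1 < gromovProduct w (a.1 i) (b.1 i) :=
    eventually_lt_of_lt_boundaryGromovProduct
      ((EReal.coe_lt_coe_iff.2 (by linarith)).trans_le hζ₁)
  have hb' := H.eventually_lt (c := dist p w + A + 1)
    (hζ₁'.trans_lt (EReal.coe_lt_coe_iff.2 (by linarith)))
  have hc' := H.eventually_lt (c := t₀ + A + 1)
    (hζ₂'.trans_lt (EReal.coe_lt_coe_iff.2 (by linarith)))
  refine ⟨a, b, c, ?_⟩
  filter_upwards [ha, hb, hb', hc'] with i ha hb hb' hc'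
  have e1 := gromovProduct_base w p (a.1 i) (b.1 i)
  have e2 := gromovProduct_base w p (b.1 i) (c.1 i)
  have e3 := gromovProduct_base w p (c.1 i) (a.1 i)
  rw [gromovProduct_comm w p] at ha
  have hbp : dist p w - L - 1 - h ≤ gromovProduct w (b.1 i) p := by
    have := H.le_or w (b.1 i) (a.1 i) p
    rw [gromovProduct_comm w (b.1 i) (a.1 i)] at this
    rcases this with h1 | h1 <;> linarith
  have hbc : gromovProduct w (b.1 i) (c.1 i) ≤ t₀ + A + 1 + 3 * h := by
    rcases H.le_or w (a.1 i) (b.1 i) (c.1 i) with h1 | h1 <;> linarith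
  have hcp := gromovProduct_nonneg w (c.1 i) p
  rw [gromovProduct_comm w (c.1 i) (a.1 i)] at e3
  refine ⟨?_, ?_, ?_⟩ <;> linarith

/-- By stability of quasi-geodesics, `f` maps quasi-centres of three boundary points to quasi-centres
of their images, and three boundary points determine their quasi-centres up to bounded distance. -/
theorem boundaryRigid_of_productsRelativelyDense (hgeo : IsGeodesicSpace X) (hpole : HasPole X)
    {δ : ℝ} (hδ : 0 < δ) (hhyp : IsDeltaHyperbolic X δ) {w : X}
    (hd : ProductsRelativelyDense w) : BoundaryRigid X := by
  intro f hf hF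
  have H := hhyp.gromovHyperbolic hgeo
  obtain ⟨C, R, hcen⟩ := exists_quasi_center hpole H hd
  obtain ⟨C', hC'⟩ := exists_gromovProduct_map_le hgeo hδ hhyp hf C
  obtain ⟨K, E, hK, hE, hf, -⟩ := hf
  set h := 3 * δ
  have hid : ∀ (a : GromovSeq X) (q : X), ∀ᶠ i in atTop,
      C' + 2 * h + 1 ≤ gromovProduct q (f (a.1 i)) (a.1 i) := by
    intro a q
    obtain ⟨hg, he⟩ := hF a
    exact (H.equiv_of_mk_eq he).eventually_le q _
  have htransfer : ∀ p x y : X, gromovProduct p x y ≤ C →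
      C' + 2 * h + 1 ≤ gromovProduct (f p) (f x) x → C' + 2 * h + 1 ≤ gromovProduct (f p) (f y) y →
      gromovProduct (f p) x y ≤ C' + 2 * h := by
    intro p x y h1 h2 h3
    have h4 := hC' p x y h1
    have h5 := H.le_or_three (f p) (f x) x y (f y)
    rw [gromovProduct_comm (f p) y (f y)] at h5
    rcases h5 with h5 | h5 | h5 <;> linarith
  refine ⟨max (2 * (max C (C' + 2 * h)) + 2 * h) (R + dist w (f w) + (K * R + E)), fun p => ?_⟩
  rcases le_total R (dist p w) with hp | hp
  · obtain ⟨a, b, c, habc⟩ := hcen p hp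
    obtain ⟨i, ⟨hab, hbc, hca⟩, ha, hb, hc⟩ :=
      (habc.and ((hid a (f p)).and ((hid b (f p)).and (hid c (f p))))).exists
    have l1 := le_max_left C (C' + 2 * h)
    have l2 := le_max_right C (C' + 2 * h)
    exact le_max_of_le_left (H.dist_le_of_centers (hab.trans l1) (hbc.trans l1) (hca.trans l1)
      ((htransfer _ _ _ hab ha hb).trans l2) ((htransfer _ _ _ hbc hb hc).trans l2)
      ((htransfer _ _ _ hca hc ha).trans l2))
  · refine le_max_of_le_right ?_
    have h1 := dist_triangle4 p w (f w) (f p)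
    have h2 := (hf w p).2
    rw [dist_comm w p] at h2
    have h3 : K * dist p w ≤ K * R := mul_le_mul_of_nonneg_left hp (by linarith)
    linarith

end Pole

/-! ### Necks -/

section Neck

variable {X : Type*} [MetricSpace X]

lemma inducesBoundaryMap_id_of_le {h : ℝ} (H : GromovHyperbolic X h) {w : X} {f : X → X} {C : ℝ}
    (hf : ∀ a, dist a w / 2 - C ≤ gromovProduct w a (f a)) : InducesBoundaryMap f id := by
  intro x
  have hlarge : ∀ b : ℝ, ∃ N, ∀ i ≥ N, b ≤ gromovProduct w (x.1 i) (f (x.1 i)) := by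
    intro b
    obtain ⟨N, hN⟩ := x.2.exists_le w (2 * (b + C))
    refine ⟨N, fun i hi => ?_⟩
    have h1 := hN i hi i hi
    rw [gromovProduct_self] at h1
    linarith [hf (x.1 i)]
  have hseq : IsGromovSeq (fun i => f (x.1 i)) := by
    refine isGromovSeq_of_exists_le w fun b => ?_
    obtain ⟨N, hN⟩ := x.2.exists_le w (b + 2 * h)
    obtain ⟨M, hM⟩ := hlarge (b + 2 * h)
    refine ⟨max N M, fun i hi j hj => ?_⟩
    have h1 := hN i (le_trans (le_max_left _ _) hi) j (le_trans (le_max_left _ _) hj)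
    have h2 := hM i (le_trans (le_max_right _ _) hi)
    have h3 := hM j (le_trans (le_max_right _ _) hj)
    have h4 := H.le_or_three w (f (x.1 i)) (x.1 i) (x.1 j) (f (x.1 j))
    rw [gromovProduct_comm w (f (x.1 i)) (x.1 i)] at h4
    rcases h4 with h4 | h4 | h4 <;> linarith
  refine ⟨hseq, Quot.sound fun w' => tendsto_atTop.2 fun b => ?_⟩
  obtain ⟨N, hN⟩ := hlarge (b + dist w w')
  filter_upwards [eventually_ge_atTop N] with i hi
  have h1 := gromovProduct_le_add_dist w w' (f (x.1 i)) (x.1 i)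
  rw [gromovProduct_comm w] at h1
  linarith [hN i hi]

/-- A neck of length `A` at height `T` in the direction of `u`, seen from `w`: a point `z` whose
Gromov product with `u` lies in `[T, T + A]` has a distance to `w` exceeding that product by at most
`R`, so that it is near the geodesic `γ` from `w` to `u`. -/
structure Neck (w : X) (R : ℝ) where
  /-- The height at which the neck begins. -/
  T : ℝ
  /-- The length of the neck. -/
  A : ℝ
  /-- The point that fixes the direction of the neck. -/
  u : X
  /-- A geodesic from `w` to `u`, the core of the neck. -/
  γ : ℝ → X
  T_nonneg : 0 ≤ T
  A_nonneg : 0 ≤ A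
  path : IsGeodesicPath w u γ
  le_dist : T + A ≤ dist u w
  thin : ∀ z, T ≤ gromovProduct w z u → gromovProduct w z u ≤ T + A →
    dist z w ≤ gromovProduct w z u + R

namespace Neck

variable {w : X} {R : ℝ} (N : Neck w R)

/-- The points of the neck. -/
def Mem (z : X) : Prop := N.T ≤ gromovProduct w z N.u ∧ gromovProduct w z N.u ≤ N.T + N.A

/-- A piecewise linear homeomorphism of `[T, T + A]` with slopes `1/2` and `2`, which moves
`T + 2A/3` to `T + A/3`. -/
noncomputable def slide (s : ℝ) : ℝ := N.T + max ((s - N.T) / 2) (2 * (s - N.T) - N.A)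

open Classical in
/-- Slide the points of the neck along its core, and fix all other points. -/
noncomputable def move (z : X) : X := if N.Mem z then N.γ (N.slide (gromovProduct w z N.u)) else z

lemma move_of_mem {z : X} (hz : N.Mem z) :
    N.move z = N.γ (N.slide (gromovProduct w z N.u)) := if_pos hz

lemma move_of_not_mem {z : X} (hz : ¬ N.Mem z) : N.move z = z := if_neg hz

lemma slide_le {s : ℝ} (h1 : N.T ≤ s) (h2 : s ≤ N.T + N.A) : N.slide s ≤ s := by
  have : max ((s - N.T) / 2) (2 * (s - N.T) - N.A) ≤ s - N.T := max_le (by linarith) (by linarith)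
  simp only [slide]; linarith

lemma half_le_slide (s : ℝ) : (s - N.T) / 2 ≤ N.slide s - N.T := by
  have := le_max_left ((s - N.T) / 2) (2 * (s - N.T) - N.A)
  simp only [slide]; linarith

lemma two_mul_le_slide (s : ℝ) : 2 * (s - N.T) - N.A ≤ N.slide s - N.T := by
  have := le_max_right ((s - N.T) / 2) (2 * (s - N.T) - N.A)
  simp only [slide]; linarith

lemma slide_sub_le {s t : ℝ} (hst : s ≤ t) :
    (t - s) / 2 ≤ N.slide t - N.slide s ∧ N.slide t - N.slide s ≤ 2 * (t - s) := by
  simp only [slide]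
  rcases max_cases ((s - N.T) / 2) (2 * (s - N.T) - N.A) with ⟨e, h⟩ | ⟨e, h⟩ <;>
    rcases max_cases ((t - N.T) / 2) (2 * (t - N.T) - N.A) with ⟨e', h'⟩ | ⟨e', h'⟩ <;>
    rw [e, e'] <;> constructor <;> linarith

lemma abs_slide_sub (s t : ℝ) : |s - t| / 2 ≤ |N.slide s - N.slide t| ∧
    |N.slide s - N.slide t| ≤ 2 * |s - t| := by
  wlog hst : s ≤ t generalizing s t
  · rw [abs_sub_comm s t, abs_sub_comm (N.slide s)]
    exact this t s (le_of_not_ge hst)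
  have h := N.slide_sub_le hst
  rw [abs_sub_comm s t, abs_sub_comm (N.slide s), abs_of_nonneg (by linarith : 0 ≤ t - s),
    abs_of_nonneg (by linarith [h.1] : 0 ≤ N.slide t - N.slide s)]
  exact h

lemma exists_slide_eq {s : ℝ} (h1 : N.T ≤ s) (h2 : s ≤ N.T + N.A) :
    ∃ t, N.T ≤ t ∧ t ≤ N.T + N.A ∧ N.slide t = s := by
  rcases le_total (3 * (s - N.T)) N.A with h | h
  · refine ⟨N.T + 2 * (s - N.T), by linarith, by linarith, ?_⟩
    simp only [slide]
    rw [max_eq_left (by linarith)]; ring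
  · refine ⟨N.T + (s - N.T + N.A) / 2, by linarith [N.A_nonneg], by linarith, ?_⟩
    simp only [slide]
    rw [max_eq_right (by linarith)]; ring

lemma dist_core {s : ℝ} (h1 : 0 ≤ s) (h2 : s ≤ N.T + N.A) : dist (N.γ s) w = s := by
  have h := N.path.2.2 s ⟨h1, by rw [dist_comm]; exact h2.trans N.le_dist⟩ 0 ⟨le_rfl, dist_nonneg⟩
  rwa [N.path.1, sub_zero, abs_of_nonneg h1] at h

lemma dist_core_core {s t : ℝ} (hs : 0 ≤ s) (hs' : s ≤ N.T + N.A) (ht : 0 ≤ t)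
    (ht' : t ≤ N.T + N.A) : dist (N.γ s) (N.γ t) = |s - t| :=
  N.path.2.2 s ⟨hs, by rw [dist_comm]; exact hs'.trans N.le_dist⟩ t
    ⟨ht, by rw [dist_comm]; exact ht'.trans N.le_dist⟩

lemma gromovProduct_core {s : ℝ} (h1 : 0 ≤ s) (h2 : s ≤ N.T + N.A) :
    gromovProduct w (N.γ s) N.u = s := by
  have hle : s ≤ dist w N.u := by rw [dist_comm]; exact h2.trans N.le_dist
  have h := N.path.2.2 s ⟨h1, hle⟩ (dist w N.u) ⟨dist_nonneg, le_rfl⟩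
  rw [N.path.2.1, abs_sub_comm, abs_of_nonneg (by linarith)] at h
  simp only [gromovProduct]
  rw [h, N.dist_core h1 h2, dist_comm N.u w]
  ring

lemma mem_core {s : ℝ} (h1 : N.T ≤ s) (h2 : s ≤ N.T + N.A) : N.Mem (N.γ s) := by
  rw [Mem, N.gromovProduct_core (N.T_nonneg.trans h1) h2]
  exact ⟨h1, h2⟩

lemma slide_mem {s : ℝ} (h1 : N.T ≤ s) (h2 : s ≤ N.T + N.A) :
    N.T ≤ N.slide s ∧ N.slide s ≤ N.T + N.A :=
  ⟨by linarith [N.half_le_slide s], (N.slide_le h1 h2).trans h2⟩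

lemma move_mem {z : X} (hz : N.Mem z) : N.Mem (N.move z) := by
  rw [N.move_of_mem hz]
  have h := N.slide_mem hz.1 hz.2
  exact N.mem_core h.1 h.2

lemma le_dist_of_mem {z : X} (hz : N.Mem z) : N.T ≤ dist z w :=
  hz.1.trans (gromovProduct_le_left w z N.u)

lemma dist_le_of_mem {z : X} (hz : N.Mem z) : dist z w ≤ N.T + N.A + R := by
  linarith [N.thin z hz.1 hz.2, hz.2]

variable {h : ℝ} (H : GromovHyperbolic X h)
include H

/-- Distances to points of the core, from the tripod formed by `w`, `u` and `z`. -/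
lemma abs_dist_core_sub_le (z : X) {s : ℝ} (h1 : 0 ≤ s) (h2 : s ≤ N.T + N.A) :
    |dist z (N.γ s) - (dist z w + s - 2 * min (gromovProduct w z N.u) s)| ≤ 2 * h := by
  have e1 := N.dist_core h1 h2
  have e2 := N.gromovProduct_core h1 h2
  have e3 : dist z (N.γ s) = dist z w + s - 2 * gromovProduct w z (N.γ s) := by
    simp only [gromovProduct]; rw [e1]; ring
  have l1 := gromovProduct_le_right w z (N.γ s)
  rw [e1] at l1
  have l2 := H w z N.u (N.γ s)
  rw [gromovProduct_comm w N.u, e2] at l2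
  have l3 := H.le_or w z (N.γ s) N.u
  rw [e2] at l3
  have h0 : 0 ≤ h := haveI : Nonempty X := ⟨w⟩; H.nonneg
  have l4 : gromovProduct w z (N.γ s) ≤ min (gromovProduct w z N.u) s + h := by
    rw [← min_add_add_right]
    refine le_min ?_ (by linarith)
    rcases l3 with l3 | l3 <;> linarith
  rw [e3, abs_le]
  constructor <;> linarith

lemma dist_core_le_of_mem {z : X} (hz : N.Mem z) :
    dist z (N.γ (gromovProduct w z N.u)) ≤ R + 2 * h := by
  have h1 := (abs_le.1 (N.abs_dist_core_sub_le H z (N.T_nonneg.trans hz.1) hz.2)).2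
  rw [min_self] at h1
  linarith [N.thin z hz.1 hz.2]

lemma dist_move_of_mem_of_not_mem {a b : X} (ha : N.Mem a) (hb : ¬ N.Mem b) :
    dist (N.move a) b ≤ 2 * dist a b + (2 * R + 20 * h) ∧
      dist a b ≤ 2 * dist (N.move a) b + (2 * R + 20 * h) := by
  have h0 : 0 ≤ h := haveI : Nonempty X := ⟨w⟩; H.nonneg
  have c1 := N.dist_core_le_of_mem H ha
  have hR : 0 ≤ R + 2 * h := dist_nonneg.trans c1
  rw [N.move_of_mem ha]
  obtain ⟨ha1, ha2⟩ := ha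
  set s := gromovProduct w a N.u with hs
  have hs0 := N.T_nonneg.trans ha1
  have sm := N.slide_mem ha1 ha2
  have c2 := abs_le.1 (N.abs_dist_core_sub_le H b hs0 ha2)
  have c3 := abs_le.1 (N.abs_dist_core_sub_le H b (N.T_nonneg.trans sm.1) sm.2)
  have t1 := dist_triangle a (N.γ s) b
  have t2 := dist_triangle_left (N.γ s) b a
  have hl := gromovProduct_le_left w b N.u
  have s1 := N.slide_le ha1 ha2
  have s2 := N.half_le_slide s
  have s3 := N.two_mul_le_slide s
  have hdist : 0 ≤ dist a b := dist_nonneg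
  have hdist' : 0 ≤ dist b (N.γ (N.slide s)) := dist_nonneg
  have hdist'' : 0 ≤ dist b (N.γ s) := dist_nonneg
  rw [dist_comm (N.γ s) b] at t1 t2
  rw [dist_comm (N.γ (N.slide s)) b]
  rcases lt_or_ge (gromovProduct w b N.u) N.T with hbT | hbT
  · rw [min_eq_left (by linarith)] at c2 c3
    constructor <;> linarith
  · have hbA : N.T + N.A < gromovProduct w b N.u := not_le.1 fun hle => hb ⟨hbT, hle⟩
    rw [min_eq_right (by linarith)] at c2 c3
    constructor <;> linarith

/-- Sliding along a neck is a quasi-isometry, with constants independent of the neck. -/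
lemma dist_move (a b : X) :
    dist (N.move a) (N.move b) ≤ 2 * dist a b + (4 * |R| + 20 * h) ∧
      dist a b ≤ 2 * dist (N.move a) (N.move b) + (4 * |R| + 20 * h) := by
  have h0 : 0 ≤ h := haveI : Nonempty X := ⟨w⟩; H.nonneg
  have hR := le_abs_self R
  have hR0 := abs_nonneg R
  have hd := dist_nonneg (x := a) (y := b)
  by_cases ha : N.Mem a <;> by_cases hb : N.Mem b
  · have ca := N.dist_core_le_of_mem H ha
    have cb := N.dist_core_le_of_mem H hb
    rw [N.move_of_mem ha, N.move_of_mem hb]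
    obtain ⟨ha1, ha2⟩ := ha
    obtain ⟨hb1, hb2⟩ := hb
    have sa := N.slide_mem ha1 ha2
    have sb := N.slide_mem hb1 hb2
    have hT := N.T_nonneg
    rw [N.dist_core_core (hT.trans sa.1) sa.2 (hT.trans sb.1) sb.2]
    have e := N.dist_core_core (hT.trans ha1) ha2 (hT.trans hb1) hb2
    have hsl := N.abs_slide_sub (gromovProduct w a N.u) (gromovProduct w b N.u)
    have t1 := dist_triangle4 a (N.γ (gromovProduct w a N.u)) (N.γ (gromovProduct w b N.u)) b
    have t2 := dist_triangle4 (N.γ (gromovProduct w a N.u)) a b (N.γ (gromovProduct w b N.u))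
    rw [e, dist_comm (N.γ (gromovProduct w b N.u)) b] at t1
    rw [e, dist_comm (N.γ (gromovProduct w a N.u)) a] at t2
    constructor <;> linarith [hsl.1, hsl.2]
  · have := N.dist_move_of_mem_of_not_mem H ha hb
    rw [N.move_of_not_mem hb]
    constructor <;> linarith [this.1, this.2]
  · have := N.dist_move_of_mem_of_not_mem H hb ha
    rw [N.move_of_not_mem ha, dist_comm a, dist_comm a]
    constructor <;> linarith [this.1, this.2]
  · rw [N.move_of_not_mem ha, N.move_of_not_mem hb]
    constructor <;> linarith

lemma half_dist_le_gromovProduct_move (z : X) :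
    dist z w / 2 - (2 * |R| + h) ≤ gromovProduct w z (N.move z) := by
  have h0 : 0 ≤ h := haveI : Nonempty X := ⟨w⟩; H.nonneg
  have hR := le_abs_self R
  have hR0 := abs_nonneg R
  have hd := dist_nonneg (x := z) (y := w)
  by_cases hz : N.Mem z
  · have c := N.dist_core_le_of_mem H hz
    have hthin := N.thin z hz.1 hz.2
    have hl := gromovProduct_le_left w z N.u
    have hT := N.T_nonneg
    have sm := N.slide_mem hz.1 hz.2
    have s1 := N.slide_le hz.1 hz.2
    have s2 := N.half_le_slide (gromovProduct w z N.u)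
    have e1 := N.dist_core (hT.trans sm.1) sm.2
    have e2 := N.dist_core_core (hT.trans hz.1) hz.2 (hT.trans sm.1) sm.2
    rw [abs_of_nonneg (by linarith)] at e2
    have t := dist_triangle z (N.γ (gromovProduct w z N.u))
      (N.γ (N.slide (gromovProduct w z N.u)))
    rw [N.move_of_mem hz]
    rw [gromovProduct, e1]
    linarith
  · rw [N.move_of_not_mem hz, gromovProduct_self]
    linarith

end Neck

/-! ### Long necks where the boundary is not uniformly perfect -/

/-- A long window free of Gromov products `(ξ|ζ)_w` produces a long neck in the direction of `ξ`:
a point far from the core of the neck would lie, by the existence of a pole, on the way to a boundary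
point `ζ` branching off inside the window. -/
lemma exists_neck (hgeo : IsGeodesicSpace X) (hpole : HasPole X) {h : ℝ}
    (H : GromovHyperbolic X h) {w : X} (hd : ¬ ProductsRelativelyDense w) :
    ∃ R : ℝ, 0 ≤ R ∧ ∀ (n : ℕ) (T₀ : ℝ), ∃ N : Neck w R, T₀ ≤ N.T ∧ N.A = n := by
  have h0 : 0 ≤ h := haveI : Nonempty X := ⟨w⟩; H.nonneg
  obtain ⟨L, hL, hpole⟩ := hpole.exists_gromovSeq H w
  refine ⟨L + h, by positivity, fun n T₀ => ?_⟩
  have hgap : ∃ (ξ : GromovBoundary X) (t : ℝ), max T₀ 0 ≤ t ∧ ∀ ζ,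
      (t : EReal) ≤ boundaryGromovProduct w ξ ζ →
        ¬ boundaryGromovProduct w ξ ζ ≤ (t + (n + 6 * h) : ℝ) := by
    by_contra hcon
    push Not at hcon
    exact hd ⟨n + 6 * h, max T₀ 0, by positivity, le_max_right _ _, hcon⟩
  obtain ⟨ξ, t, ht, hgap⟩ := hgap
  have ht0 := (le_max_right T₀ 0).trans ht
  have hT₀ : T₀ ≤ t + 4 * h := by linarith [le_max_left T₀ 0]
  obtain ⟨x, rfl⟩ := Quot.exists_rep ξ
  obtain ⟨M, hM⟩ := x.2.exists_le w (t + n + 6 * h + 1)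
  obtain ⟨γ, hγ⟩ := hgeo.exists_path w (x.1 M)
  have hu := (hM M le_rfl M le_rfl).trans (gromovProduct_le_left w _ _)
  refine ⟨⟨t + 4 * h, n, x.1 M, γ, by positivity, by positivity, hγ, by linarith, fun z hz1 hz2 => ?_⟩,
    hT₀, rfl⟩
  by_contra hlt
  rw [not_le] at hlt
  obtain ⟨y, hy⟩ := hpole z
  set s := gromovProduct w z (x.1 M) with hs
  have hev : ∀ᶠ j in atTop, s - 2 * h ≤ gromovProduct w (x.1 j) (y.1 j) ∧
      gromovProduct w (x.1 j) (y.1 j) ≤ s + 2 * h := by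
    filter_upwards [hy, eventually_ge_atTop M] with j hy hj
    have hxx := hM j hj M le_rfl
    have h1 := H.le_or w (y.1 j) z (x.1 M)
    have h2 := H.le_or w z (y.1 j) (x.1 M)
    have h3 := H.le_or w (x.1 j) (x.1 M) (y.1 j)
    have h4 := H.le_or w (x.1 M) (x.1 j) (y.1 j)
    rw [gromovProduct_comm w (y.1 j) z, ← hs] at h1
    rw [← hs] at h2
    rw [gromovProduct_comm w (x.1 M) (y.1 j)] at h3 h4
    rw [gromovProduct_comm w (x.1 M) (x.1 j)] at h4
    constructor
    · rcases h1 with h1 | h1 <;> rcases h3 with h3 | h3 <;> linarith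
    · rcases h2 with h2 | h2 <;> rcases h4 with h4 | h4 <;> linarith
  refine hgap (GromovBoundary.mk y) ?_ ?_
  · have h1 : ((s - 4 * h : ℝ) : EReal) ≤
        boundaryGromovProduct w (GromovBoundary.mk x) (GromovBoundary.mk y) :=
      H.le_boundaryGromovProduct_of_frequently
        (hev.mono fun j hj => by linarith [hj.1]).frequently
    exact (EReal.coe_le_coe_iff.2 (by linarith)).trans h1
  · have h1 : boundaryGromovProduct w (GromovBoundary.mk x) (GromovBoundary.mk y) ≤
        ((s + 2 * h : ℝ) : EReal) :=
      boundaryGromovProduct_le (hev.mono fun j hj => hj.2).frequently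
    exact h1.trans (EReal.coe_le_coe_iff.2 (by linarith))

/-- Infinitely many necks of growing length, in disjoint ranges of heights. -/
lemma exists_separated_necks (hgeo : IsGeodesicSpace X) (hpole : HasPole X) {h : ℝ}
    (H : GromovHyperbolic X h) {w : X} (hd : ¬ ProductsRelativelyDense w) :
    ∃ (R : ℝ) (N : ℕ → Neck w R), (∀ n, (N n).A = n) ∧
      ∀ n m, n < m → (N n).T + (N n).A + R < (N m).T := by
  obtain ⟨R, hR, hN⟩ := exists_neck hgeo hpole H hd
  choose F hF1 hF2 using hN
  let N : ℕ → Neck w R := fun n =>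
    Nat.rec (F 0 0) (fun n M => F (n + 1) (M.T + M.A + R + 1)) n
  have hstep : ∀ n, (N n).T + (N n).A + R + 1 ≤ (N (n + 1)).T := fun n => hF1 (n + 1) _
  refine ⟨R, N, fun n => ?_, fun n m hnm => ?_⟩
  · cases n with
    | zero => exact hF2 0 0
    | succ n => exact hF2 (n + 1) _
  · induction m, hnm using Nat.le_induction with
    | base => linarith [hstep n]
    | succ m _ ih => linarith [hstep m, (N m).A_nonneg]

open Classical in
/-- Slide along all the necks of a family simultaneously. -/
noncomputable def moveAll {w : X} {R : ℝ} (N : ℕ → Neck w R) (z : X) : X :=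
  if hz : ∃ n, (N n).Mem z then (N hz.choose).move z else z

section MoveAll

variable {w : X} {R : ℝ} {N : ℕ → Neck w R}

lemma moveAll_of_not_mem {z : X} (hz : ∀ n, ¬ (N n).Mem z) : moveAll N z = z :=
  dif_neg (not_exists.2 hz)

variable (hsep : ∀ n m, n < m → (N n).T + (N n).A + R < (N m).T)
include hsep

lemma eq_of_mem_of_mem {n m : ℕ} {z : X} (hn : (N n).Mem z) (hm : (N m).Mem z) : n = m := by
  by_contra hne
  rcases lt_or_gt_of_ne hne with hlt | hlt
  · linarith [hsep n m hlt, (N n).dist_le_of_mem hn, (N m).le_dist_of_mem hm]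
  · linarith [hsep m n hlt, (N m).dist_le_of_mem hm, (N n).le_dist_of_mem hn]

lemma moveAll_of_mem {n : ℕ} {z : X} (hz : (N n).Mem z) : moveAll N z = (N n).move z := by
  have hex : ∃ n, (N n).Mem z := ⟨n, hz⟩
  rw [moveAll, dif_pos hex, eq_of_mem_of_mem hsep hex.choose_spec hz]

/-- Distances between images involve at most two necks, and slides along different necks do not
interfere. -/
lemma dist_moveAll {h : ℝ} (H : GromovHyperbolic X h) (a b : X) :
    dist (moveAll N a) (moveAll N b) ≤ 4 * dist a b + 3 * (4 * |R| + 20 * h) ∧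
      dist a b ≤ 4 * dist (moveAll N a) (moveAll N b) + 3 * (4 * |R| + 20 * h) := by
  have h0 : 0 ≤ h := haveI : Nonempty X := ⟨w⟩; H.nonneg
  have hR0 := abs_nonneg R
  have hd := dist_nonneg (x := a) (y := b)
  have hd' := dist_nonneg (x := moveAll N a) (y := moveAll N b)
  -- It suffices to move `a` and `b` by one neck, then by another one.
  have key : ∀ n m : ℕ, moveAll N a = (N m).move ((N n).move a) →
      moveAll N b = (N m).move ((N n).move b) →
      dist (moveAll N a) (moveAll N b) ≤ 4 * dist a b + 3 * (4 * |R| + 20 * h) ∧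
        dist a b ≤ 4 * dist (moveAll N a) (moveAll N b) + 3 * (4 * |R| + 20 * h) := by
    intro n m ea eb
    have h1 := (N n).dist_move H a b
    have h2 := (N m).dist_move H ((N n).move a) ((N n).move b)
    rw [← ea, ← eb] at h2
    constructor <;> linarith [h1.1, h1.2, h2.1, h2.2]
  have one : ∀ n : ℕ, moveAll N a = (N n).move a → moveAll N b = (N n).move b →
      dist (moveAll N a) (moveAll N b) ≤ 4 * dist a b + 3 * (4 * |R| + 20 * h) ∧
        dist a b ≤ 4 * dist (moveAll N a) (moveAll N b) + 3 * (4 * |R| + 20 * h) := by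
    intro n ea eb
    have h1 := (N n).dist_move H a b
    rw [← ea, ← eb] at h1
    constructor <;> linarith [h1.1, h1.2]
  by_cases ha : ∃ n, (N n).Mem a <;> by_cases hb : ∃ m, (N m).Mem b
  · obtain ⟨n, ha⟩ := ha
    obtain ⟨m, hb⟩ := hb
    have ea := moveAll_of_mem hsep ha
    have eb := moveAll_of_mem hsep hb
    by_cases hnm : n = m
    · subst hnm
      exact one n ea eb
    · refine key n m ?_ ?_
      · rw [ea, (N m).move_of_not_mem fun hm => hnm (eq_of_mem_of_mem hsep ((N n).move_mem ha) hm)]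
      · rw [eb, (N n).move_of_not_mem fun hn => hnm (eq_of_mem_of_mem hsep hn hb)]
  · obtain ⟨n, ha⟩ := ha
    rw [not_exists] at hb
    exact one n (moveAll_of_mem hsep ha)
      (by rw [moveAll_of_not_mem hb, (N n).move_of_not_mem (hb n)])
  · obtain ⟨n, hb⟩ := hb
    rw [not_exists] at ha
    exact one n (by rw [moveAll_of_not_mem ha, (N n).move_of_not_mem (ha n)])
      (moveAll_of_mem hsep hb)
  · rw [not_exists] at ha hb
    rw [moveAll_of_not_mem ha, moveAll_of_not_mem hb]
    constructor <;> linarith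

lemma isQuasiIsometry_moveAll {h : ℝ} (H : GromovHyperbolic X h) :
    IsQuasiIsometry (moveAll N) := by
  have h0 : 0 ≤ h := haveI : Nonempty X := ⟨w⟩; H.nonneg
  have hR := le_abs_self R
  have hR0 := abs_nonneg R
  refine ⟨4, 3 * (4 * |R| + 20 * h), by norm_num, by positivity, fun a b => ?_, fun y => ?_⟩
  · have := dist_moveAll hsep H a b
    constructor
    · linarith [this.2]
    · exact this.1
  · by_cases hy : ∃ n, (N n).Mem y
    · obtain ⟨n, hy⟩ := hy
      obtain ⟨t, ht1, ht2, ht⟩ := (N n).exists_slide_eq hy.1 hy.2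
      have hm := (N n).mem_core ht1 ht2
      refine ⟨(N n).γ t, ?_⟩
      rw [moveAll_of_mem hsep hm, (N n).move_of_mem hm,
        (N n).gromovProduct_core ((N n).T_nonneg.trans ht1) ht2, ht]
      linarith [(N n).dist_core_le_of_mem H hy]
    · rw [not_exists] at hy
      refine ⟨y, ?_⟩
      rw [moveAll_of_not_mem hy, dist_self]
      positivity

lemma inducesBoundaryMap_moveAll {h : ℝ} (H : GromovHyperbolic X h) :
    InducesBoundaryMap (moveAll N) id := by
  refine inducesBoundaryMap_id_of_le H (w := w) (C := 2 * |R| + h) fun z => ?_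
  by_cases hz : ∃ n, (N n).Mem z
  · obtain ⟨n, hz⟩ := hz
    rw [moveAll_of_mem hsep hz]
    exact (N n).half_dist_le_gromovProduct_move H z
  · rw [not_exists] at hz
    rw [moveAll_of_not_mem hz, ← (N 0).move_of_not_mem (hz 0)]
    simpa only [(N 0).move_of_not_mem (hz 0)] using (N 0).half_dist_le_gromovProduct_move H z

lemma exists_dist_moveAll_eq (n : ℕ) :
    ∃ z, dist z (moveAll N z) = (N n).A / 3 := by
  have hA := (N n).A_nonneg
  have hT := (N n).T_nonneg
  have h1 : (N n).T ≤ (N n).T + 2 * (N n).A / 3 := by linarith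
  have h2 : (N n).T + 2 * (N n).A / 3 ≤ (N n).T + (N n).A := by linarith
  have hm := (N n).mem_core h1 h2
  have e : (N n).slide ((N n).T + 2 * (N n).A / 3) = (N n).T + (N n).A / 3 := by
    simp only [Neck.slide]
    rw [max_eq_left (by linarith)]; ring
  refine ⟨(N n).γ ((N n).T + 2 * (N n).A / 3), ?_⟩
  rw [moveAll_of_mem hsep hm, (N n).move_of_mem hm, (N n).gromovProduct_core (hT.trans h1) h2, e,
    (N n).dist_core_core (by linarith) h2 (by linarith) (by linarith),
    abs_of_nonneg (by linarith)]
  ring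

end MoveAll

theorem not_boundaryRigid_of_not_productsRelativelyDense (hgeo : IsGeodesicSpace X)
    (hpole : HasPole X) {h : ℝ} (H : GromovHyperbolic X h) {w : X}
    (hd : ¬ ProductsRelativelyDense w) : ¬ BoundaryRigid X := by
  obtain ⟨R, N, hA, hsep⟩ := exists_separated_necks hgeo hpole H hd
  intro hrigid
  obtain ⟨M, hM⟩ := hrigid _ (isQuasiIsometry_moveAll hsep H) (inducesBoundaryMap_moveAll hsep H)
  obtain ⟨n, hn⟩ := exists_nat_gt (3 * M)
  obtain ⟨z, hz⟩ := exists_dist_moveAll_eq hsep n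
  have := hM z
  rw [hz, hA] at this
  linarith

end Neck

end BoundaryRigidity

theorem theorem1p1 {X : Type*} [MetricSpace X] [ProperSpace X]
    (hgeo : IsGeodesicSpace X) (hpole : HasPole X)
    (δ : ℝ) (hδ : 0 < δ) (hhyp : IsDeltaHyperbolic X δ)
    (w : X) (ε : ℝ) (hε : 0 < ε) (hεδ : ε < min 1 (1 / (5 * δ))) :
    BoundaryRigid X ↔ UniformlyPerfect (visualDist w ε) := by
  have H := hhyp.gromovHyperbolic hgeo
  have hK : Real.exp (ε * (3 * δ)) ≤ 2 := by
    have h1 : ε * (5 * δ) < 1 :=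
      (lt_div_iff₀ (by positivity)).1 (hεδ.trans_le (min_le_right _ _))
    rw [← Real.le_log_iff_exp_le (by norm_num)]
    linarith [Real.log_two_gt_d9]
  rw [uniformlyPerfect_visualDist_iff H w hε hK]
  refine ⟨fun hr => ?_, boundaryRigid_of_productsRelativelyDense hgeo hpole hδ hhyp⟩
  by_contra hd
  exact not_boundaryRigid_of_not_productsRelativelyDense hgeo hpole H hd hr
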